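/- Let $\mathbb D=\{x\in\mathbb R^2:|x|<1\}$. For $\Omega\subset\mathbb R^2$ and $z=u+\mathrm i v:\Omega\to\mathbb C$ write $\langle\nabla z,\nabla z\rangle=|\nabla u|^2+|\nabla v|^2$, $\langle z,\triangle z\rangle=u\triangle u+v\triangle v$, $$E_\Omega(z)=\int_\Omega\frac{2\langle\nabla z,\nabla z\rangle}{(1+|z|^2)^2}\,dx,\qquad \mathcal E_\Omega(z)=-\int_\Omega\Big\langle\nabla\frac{2}{(1+|z|^2)^2},\,u\nabla u+v\nabla v\Big\rangle dx-\int_\Omega\frac{2\langle z,\triangle z\rangle}{(1+|z|^2)^2}\,dx .$$ Thus $\mathcal E_\Omega$ is the Dirichlet energy $E_\Omega$ after integration by parts with the boundary integral omitted. Put $E_S=E_{\mathbb D}$ and $E_N=E_{\mathbb R^2\setminus\mathbb D}$, and $\mathcal E_S$, $\mathcal E_N$ likewise. **Theorem.** Let $\underline z_c:\mathbb R^2\setminus\mathbb D\to\mathbb C\setminus\{0\}$ be $C^2$ (up to the unit circle) with $E_N(\underline z_c)<\infty$, and let it be a critical point of $E_N$: $\frac{d}{dt}E_N(\underline z_c+t\varphi)|_{t=0}=0$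 for all smooth $\varphi$ with compact support in $\{|x|>1\}$. Let $\zeta=1/\overline{\underline z_c}=\mu+\mathrm i\nu$. Then: 1. On $\{|x|>1\}$ the pair $(\mathbf u,\mathbf v)=(\mu,\nu)$ satisfies the Euler–Lagrange equations $$-\triangle\mathbf u=\frac{-2\mathbf u|\nabla\mathbf u|^2+2\mathbf u|\nabla\mathbf v|^2-4\mathbf v\langle\nabla\mathbf u,\nabla\mathbf v\rangle}{1+\mathbf u^2+\mathbf v^2},\qquad -\triangle\mathbf v=\frac{-2\mathbf v|\nabla\mathbf v|^2+2\mathbf v|\nabla\mathbf u|^2-4\mathbf u\langle\nabla\mathbf u,\nabla\mathbf v\rangle}{1+\mathbf u^2+\mathbf v^2}.$$ 2. All the integrals below converge, $E_N(\zeta)=E_N(\underline z_c)$, and $$E_N(\zeta)=\mathcal E_N(\underline z_c)-\oint_{|x|=1}\frac{2\langle\underline z_c,\partial_r\underline z_c\rangle}{(1+|\underline z_c|^2)^2}\,ds,$$ where $\mathcal E_N(\underline z_c)$, the northern energy without its boundary integral, has the decomposition $$\mathcal E_N(\underline z_c)=\int_{\mathbb R^2\setminus\mathbb D}\frac{-|\nabla\ln(1+|\zeta|^2)|^2}{1+|\zeta|^2}\,dx+\int_{\mathbb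 R^2\setminus\mathbb D}\frac{4\langle\nabla\zeta,\nabla\zeta\rangle}{(1+|\zeta|^2)^2}\,dx-\int_{\mathbb R^2\setminus\mathbb D}\frac{4}{1+|\zeta|^2}\,\frac{\mu^2|\nabla\nu|^2-2\mu\nu\langle\nabla\mu,\nabla\nu\rangle+\nu^2|\nabla\mu|^2}{(1+|\zeta|^2)^2}\,dx .$$ The boundary integrals cancel in the total energy: if $z$ is $C^2$ on $\overline{\mathbb D}$ and $z=\underline z_c$, $\partial_r z=\partial_r\underline z_c$ on the unit circle, then $E_S(z)+E_N(\zeta)$ equals $\mathcal E_S(z)$ plus the right-hand side of the last formula. 3. Suppose moreover that almost everywhere $\mu^2|\nabla\nu|^2=\nu^2|\nabla\mu|^2$ and $\nabla\mu,\nabla\nu$ are linearly dependent (the minimal conditions). Then $\zeta$ minimizes $E_N$ among all maps $\eta:\mathbb R^2\setminus\mathbb D\to\mathbb C$ that are continuous, $C^1$ on $\{|x|>1\}$, of finite energy and equal to $\zeta$ on the unit circle. Also $$\mathcal E_N(\underline z_c)=-\int_{\mathbb R^2\setminus\mathbb D}\frac{|\nabla\ln(1+|\zeta|^2)|^2}{1+|\zeta|^2}\,dx+\int_{\mathbb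 R^2\setminus\mathbb D}\frac{4\langle\nabla\zeta,\nabla\zeta\rangle}{(1+|\zeta|^2)^2}\,dx ,$$ and the minimal value $E_N(\zeta)$ equals this right-hand side minus the boundary integral in 2. -/

import Mathlib

open MeasureTheory

noncomputable section

/-- The Euclidean plane `ℝ²`. -/
abbrev Plane : Type := EuclideanSpace ℝ (Fin 2)

/-- The open unit disk `𝔻`. -/
def unitDisk : Set Plane := Metric.ball 0 1

/-- The northern domain `ℝ² \ 𝔻`, with its boundary circle. -/
def northDomain : Set Plane := unitDiskᶜ

/-- The interior `{1 < |x|}` of the northern domain. -/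
def northInterior : Set Plane := (Metric.closedBall (0 : Plane) 1)ᶜ

/-- The first component `u` of `z = u + i v`. -/
def uPart (z : Plane → ℂ) : Plane → ℝ := fun x => (z x).re

/-- The second component `v` of `z = u + i v`. -/
def vPart (z : Plane → ℂ) : Plane → ℝ := fun x => (z x).im

/-- The partial derivative `f_{x^{i+1}}`. -/
def partialD (i : Fin 2) (f : Plane → ℝ) (x : Plane) : ℝ :=
  fderiv ℝ f x (EuclideanSpace.single i 1)

/-- `⟨∇z, ∇z⟩ = |∇u|² + |∇v|²`. -/
def gradSq (z : Plane → ℂ) (x : Plane) : ℝ :=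
  ‖gradient (uPart z) x‖ ^ 2 + ‖gradient (vPart z) x‖ ^ 2

/-- `2 ⟨∇z, ∇z⟩ / (1 + |z|²)²`, the Dirichlet energy density of `z` for the spherical metric
`4 (du² + dv²) / (1 + u² + v²)²` on the target. -/
def energyDensity (z : Plane → ℂ) (x : Plane) : ℝ :=
  2 * gradSq z x / (1 + ‖z x‖ ^ 2) ^ 2

/-- The Dirichlet energy of `z` on `Ω`. -/
def dirichletEnergy (Ω : Set Plane) (z : Plane → ℂ) : ℝ :=
  ∫ x in Ω, energyDensity z x

/-- The southern energy `E_S`. -/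
def energyS (z : Plane → ℂ) : ℝ := dirichletEnergy unitDisk z

/-- The northern energy `E_N`. -/
def energyN (z : Plane → ℂ) : ℝ := dirichletEnergy northDomain z

/-- `z` is a critical point of `E_N`: the first variation vanishes in the direction of every
smooth `φ` with compact support inside the northern domain. -/
def IsCriticalN (z : Plane → ℂ) : Prop :=
  ∀ φ : Plane → ℂ, ContDiff ℝ (⊤ : ℕ∞) φ → HasCompactSupport φ → tsupport φ ⊆ northInterior →
    HasDerivAt (fun t : ℝ => energyN (fun x => z x + t • φ x)) 0 0

/-- The integrand `⟨∇(2 / (1 + |z|²)²), u ∇u + v ∇v⟩`. -/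
def partsFirst (z : Plane → ℂ) (x : Plane) : ℝ :=
  inner ℝ (gradient (fun y => 2 / (1 + ‖z y‖ ^ 2) ^ 2) x)
    (uPart z x • gradient (uPart z) x + vPart z x • gradient (vPart z) x)

/-- The integrand `2 ⟨z, Δz⟩ / (1 + |z|²)²`. -/
def partsSecond (z : Plane → ℂ) (x : Plane) : ℝ :=
  2 * (uPart z x * Laplacian.laplacian (uPart z) x
    + vPart z x * Laplacian.laplacian (vPart z) x) / (1 + ‖z x‖ ^ 2) ^ 2

/-- The energy after integration by parts, with the boundary integral omitted. -/
def energyByParts (Ω : Set Plane) (z : Plane → ℂ) : ℝ :=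
  -(∫ x in Ω, partsFirst z x) - ∫ x in Ω, partsSecond z x

/-- The point `(cos θ, sin θ)`. -/
def circlePt (θ : ℝ) : Plane := !₂[Real.cos θ, Real.sin θ]

/-- The boundary integral `∮_{|x| = 1} 2 ⟨z, ∂_r z⟩ / (1 + |z|²)² ds`, where the radial derivative
`∂_r z` is taken from inside `Ω` (on the unit circle the radial unit vector at `x` is `x`). -/
def circleTerm (Ω : Set Plane) (z : Plane → ℂ) : ℝ :=
  ∫ θ in (0 : ℝ)..(2 * Real.pi),
    2 * inner ℝ (z (circlePt θ)) (fderivWithin ℝ z Ω (circlePt θ) (circlePt θ))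
      / (1 + ‖z (circlePt θ)‖ ^ 2) ^ 2

/-- The Euler–Lagrange equations for the pair `(u, v)` at the point `x`. -/
def EulerLagrangeAt (u v : Plane → ℝ) (x : Plane) : Prop :=
  -Laplacian.laplacian u x =
      (-2 * u x * partialD 0 u x ^ 2 - 2 * u x * partialD 1 u x ^ 2
        + 2 * u x * partialD 0 v x ^ 2 + 2 * u x * partialD 1 v x ^ 2
        - 4 * partialD 0 u x * partialD 0 v x * v x
        - 4 * partialD 1 u x * partialD 1 v x * v x) / (1 + u x ^ 2 + v x ^ 2) ∧
  -Laplacian.laplacian v x =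
      (-2 * v x * partialD 0 v x ^ 2 - 2 * v x * partialD 1 v x ^ 2
        + 2 * v x * partialD 0 u x ^ 2 + 2 * v x * partialD 1 u x ^ 2
        - 4 * partialD 0 u x * partialD 0 v x * u x
        - 4 * partialD 1 u x * partialD 1 v x * u x) / (1 + u x ^ 2 + v x ^ 2)

/-- The minimal conditions for the pair `(u, v)` at the point `x`. -/
def MinimalConditionsAt (u v : Plane → ℝ) (x : Plane) : Prop :=
  u x ^ 2 * ‖gradient v x‖ ^ 2 = v x ^ 2 * ‖gradient u x‖ ^ 2 ∧
  ¬ LinearIndependent ℝ ![gradient u x, gradient v x]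

/-- The inverted map `1 / conj z`. -/
def inverted (z : Plane → ℂ) : Plane → ℂ := fun x => 1 / (starRingEnd ℂ) (z x)

/-- The integrand `|∇ ln (1 + |ζ|²)|² / (1 + |ζ|²)`. -/
def logTerm (ζ : Plane → ℂ) (x : Plane) : ℝ :=
  ‖gradient (fun y => Real.log (1 + ‖ζ y‖ ^ 2)) x‖ ^ 2 / (1 + ‖ζ x‖ ^ 2)

/-- The integrand `4 ⟨∇ζ, ∇ζ⟩ / (1 + |ζ|²)²`. -/
def gradTerm (ζ : Plane → ℂ) (x : Plane) : ℝ :=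
  4 * gradSq ζ x / (1 + ‖ζ x‖ ^ 2) ^ 2

/-- The integrand
`4 / (1 + |ζ|²) * (μ² |∇ν|² - 2 μ ν ⟨∇μ, ∇ν⟩ + ν² |∇μ|²) / (1 + |ζ|²)²` for `ζ = μ + i ν`. -/
def crossTerm (ζ : Plane → ℂ) (x : Plane) : ℝ :=
  4 / (1 + ‖ζ x‖ ^ 2) *
    ((uPart ζ x ^ 2 * ‖gradient (vPart ζ) x‖ ^ 2
      - 2 * uPart ζ x * vPart ζ x * inner ℝ (gradient (uPart ζ) x) (gradient (vPart ζ) x)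
      + vPart ζ x ^ 2 * ‖gradient (uPart ζ) x‖ ^ 2) / (1 + ‖ζ x‖ ^ 2) ^ 2)

/-- The maps of finite northern energy with the same boundary values as `ζ` on the unit circle:
`C¹` in the interior of the northern domain and continuous up to the circle. -/
def competitorsN (ζ : Plane → ℂ) : Set (Plane → ℂ) :=
  {η | ContinuousOn η northDomain ∧ ContDiffOn ℝ 1 η northInterior ∧
    IntegrableOn (energyDensity η) northDomain ∧
    ∀ x ∈ Metric.sphere (0 : Plane) 1, η x = ζ x}

end

/-! The weight `4 / (1 + |z|²)²` is the round metric in stereographic coordinates, so critical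
points are harmonic maps into the sphere, and `z ↦ 1 / conj z` is the reflection in the equator, an
isometry exchanging the poles. It therefore preserves the energy density (`energyDensity_inverted`)
and the Euler–Lagrange equation (`ComplexEL.inverted`). In complex form the equation reads `(1 +
|z|²) Δz = 2 conj z ∑ (∂ᵢ z)²`; it follows from vanishing first variation by the fundamental lemma
of the calculus of variations (`complexEL_of_isCriticalN`).

The energy formula is the divergence theorem for the field `2 ⟨z, ∇z⟩ / (1 + |z|²)²`, whose
divergence is the energy density plus the two integrands of the energy by parts (`div_fluxField`).
Infinity contributes nothing: for a square integrable field, `flux(r)² / r` is integrable in `r`,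
which forces a limiting flux to vanish because `1 / r` is not integrable
(`integral_div_northInterior`). Finite energy supplies the square integrability. For the
decomposition, write `conj z ∂ᵢ z = radD + i angD`. The equation eliminates `Δz`, and both sides
become the energy density times `2 |z|² / (1 + |z|²)` (`parts_eq_inverted`).

The minimal conditions force `angD = 0`, so that the argument is locally constant and the map runs
along meridians (`angD_eq_zero_of_minimal`). This kills the cross term. It also makes the distance
to the pole, `f = 2 arctan |ζ|`, a harmonic function with `|∇f|²` equal to twice the energy density
(`div_poleField_eq_zero`, `sum_sq_poleField_eq`). For a competitor `η` the distance to the pole is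
1-Lipschitz on the sphere, so `|∇(2 arctan |η|)|²` is at most twice its density, and the Dirichlet
principle for `f` gives minimality. Since `2 arctan |η|` may fail to be differentiable at zeros of
`η`, `|η|` is replaced by `√(|η|² + ε²)`, at the price of a boundary error that tends to zero
(`energyN_le_add`, `isMinOn_energyN`). -/

section

open Set Filter Topology

/-! ### Polar coordinates and the divergence theorem on annuli -/

/-- The point of the plane with polar coordinates `p = (r, θ)`. -/
noncomputable def polarPt (p : ℝ × ℝ) : Plane := p.1 • circlePt p.2

theorem circlePt_zero (θ : ℝ) : circlePt θ 0 = Real.cos θ := rfl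

theorem circlePt_one (θ : ℝ) : circlePt θ 1 = Real.sin θ := rfl

theorem norm_circlePt (θ : ℝ) : ‖circlePt θ‖ = 1 := by
  simp [EuclideanSpace.norm_eq, circlePt_zero, circlePt_one, Fin.sum_univ_two]

theorem norm_polarPt (p : ℝ × ℝ) : ‖polarPt p‖ = |p.1| := by
  simp [polarPt, norm_smul, norm_circlePt]

theorem continuous_circlePt : Continuous circlePt := by
  unfold circlePt
  refine (PiLp.continuous_toLp 2 _).comp (continuous_pi fun i => ?_)
  fin_cases i
  · exact Real.continuous_cos
  · exact Real.continuous_sin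

theorem continuous_polarPt : Continuous polarPt :=
  continuous_fst.smul (continuous_circlePt.comp continuous_snd)

theorem circlePt_eq (θ : ℝ) : circlePt θ = Real.cos θ • EuclideanSpace.single 0 1
    + Real.sin θ • EuclideanSpace.single 1 1 := by
  ext i
  fin_cases i <;> simp [circlePt]

theorem hasDerivAt_circlePt (θ : ℝ) :
    HasDerivAt circlePt (-Real.sin θ • EuclideanSpace.single (0 : Fin 2) (1 : ℝ)
      + Real.cos θ • EuclideanSpace.single 1 1) θ := by
  have h : circlePt = fun θ => Real.cos θ • EuclideanSpace.single (0 : Fin 2) (1 : ℝ)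
      + Real.sin θ • EuclideanSpace.single 1 1 := funext circlePt_eq
  rw [h]
  exact ((Real.hasDerivAt_cos θ).smul_const _).add ((Real.hasDerivAt_sin θ).smul_const _)

/-- The identification of `ℝ × ℝ` with the Euclidean plane. -/
noncomputable def planeEquiv : ℝ × ℝ ≃ᵐ Plane :=
  MeasurableEquiv.finTwoArrow.symm.trans (MeasurableEquiv.toLp 2 (Fin 2 → ℝ))

theorem measurePreserving_planeEquiv : MeasurePreserving planeEquiv :=
  (EuclideanSpace.volume_preserving_symm_measurableEquiv_toLp (Fin 2)).symm.comp
    (volume_preserving_finTwoArrow ℝ).symm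

theorem planeEquiv_polarCoord_symm (p : ℝ × ℝ) : planeEquiv (polarCoord.symm p) = polarPt p := by
  ext i
  fin_cases i <;> simp [planeEquiv, polarPt, circlePt]

theorem integral_polarPt (f : Plane → ℝ) :
    ∫ p in polarCoord.target, p.1 * f (polarPt p) = ∫ x, f x := by
  rw [← measurePreserving_planeEquiv.integral_comp planeEquiv.measurableEmbedding,
    ← integral_comp_polarCoord_symm]
  simp only [planeEquiv_polarCoord_symm, smul_eq_mul]

theorem integrableOn_polarPt {f : Plane → ℝ} (hf : Integrable f) :
    IntegrableOn (fun p => p.1 * f (polarPt p)) polarCoord.target := by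
  have h1 : Integrable (fun p => f (planeEquiv p)) :=
    (measurePreserving_planeEquiv.integrable_comp_emb planeEquiv.measurableEmbedding).2 hf
  have h2 : IntegrableOn (fun p => f (planeEquiv p)) (polarCoord.symm '' polarCoord.target) :=
    h1.integrableOn
  rw [integrableOn_image_iff_integrableOn_abs_det_fderiv_smul volume
    polarCoord.open_target.measurableSet
    (fun p _ => (hasFDerivAt_polarCoord_symm p).hasFDerivWithinAt)
    polarCoord.symm.injOn] at h2
  refine h2.congr_fun (fun p hp => ?_) polarCoord.open_target.measurableSet
  simp only [det_fderivPolarCoordSymm, planeEquiv_polarCoord_symm, smul_eq_mul]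
  rw [abs_of_pos (show 0 < p.1 from hp.1)]

theorem polarCoord_target_inter {a b : ℝ} (ha : 0 ≤ a) :
    polarCoord.target ∩ polarPt ⁻¹' {x | a < ‖x‖ ∧ ‖x‖ < b}
      = Ioo a b ×ˢ Ioo (-Real.pi) Real.pi := by
  ext p
  simp only [polarCoord_target, mem_inter_iff, mem_prod, mem_Ioi, mem_preimage, mem_ofPred_eq,
    norm_polarPt, mem_Ioo]
  constructor
  · rintro ⟨⟨h1, h2⟩, h3, h4⟩
    rw [abs_of_pos h1] at h3 h4
    exact ⟨⟨h3, h4⟩, h2⟩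
  · rintro ⟨⟨h3, h4⟩, h2⟩
    have h1 : 0 < p.1 := ha.trans_lt h3
    rw [abs_of_pos h1]
    exact ⟨⟨h1, h2⟩, h3, h4⟩

theorem isOpen_annulus (a b : ℝ) : IsOpen {x : Plane | a < ‖x‖ ∧ ‖x‖ < b} :=
  (isOpen_lt continuous_const continuous_norm).inter (isOpen_lt continuous_norm continuous_const)

theorem mul_indicator_polarPt (s : Set Plane) (f : Plane → ℝ) :
    (fun p : ℝ × ℝ => p.1 * s.indicator f (polarPt p))
      = (polarPt ⁻¹' s).indicator fun p => p.1 * f (polarPt p) := by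
  ext p
  by_cases h : polarPt p ∈ s
  · rw [indicator_of_mem h, indicator_of_mem (show p ∈ polarPt ⁻¹' s from h)]
  · rw [indicator_of_notMem h, indicator_of_notMem (show p ∉ polarPt ⁻¹' s from h), mul_zero]

theorem setIntegral_annulus_eq {a b : ℝ} (ha : 0 ≤ a) (f : Plane → ℝ) :
    ∫ p in Ioo a b ×ˢ Ioo (-Real.pi) Real.pi, p.1 * f (polarPt p)
      = ∫ x in {x : Plane | a < ‖x‖ ∧ ‖x‖ < b}, f x := by
  have hm := (isOpen_annulus a b).measurableSet
  rw [← integral_indicator hm, ← integral_polarPt, mul_indicator_polarPt,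
    setIntegral_indicator (continuous_polarPt.measurable hm), polarCoord_target_inter ha]

theorem integrableOn_annulus_polarPt {a b : ℝ} (ha : 0 ≤ a) {f : Plane → ℝ}
    (hf : IntegrableOn f {x : Plane | a < ‖x‖ ∧ ‖x‖ < b}) :
    IntegrableOn (fun p => p.1 * f (polarPt p)) (Ioo a b ×ˢ Ioo (-Real.pi) Real.pi) := by
  have hm := (isOpen_annulus a b).measurableSet
  have h := integrableOn_polarPt (hf.integrable_indicator hm)
  rw [mul_indicator_polarPt, IntegrableOn, integrable_indicator_iff
    (continuous_polarPt.measurable hm), IntegrableOn,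
    Measure.restrict_restrict (continuous_polarPt.measurable hm), inter_comm,
    polarCoord_target_inter ha] at h
  exact h

theorem fderiv_circlePt (f : Plane → ℝ) (x : Plane) (θ : ℝ) :
    fderiv ℝ f x (circlePt θ) = Real.cos θ * partialD 0 f x + Real.sin θ * partialD 1 f x := by
  rw [circlePt_eq]
  simp [partialD]

theorem Icc_prod_ae_eq_Ioo (a b c d : ℝ) :
    (Icc (a, c) (b, d) : Set (ℝ × ℝ)) =ᵐ[volume] Ioo a b ×ˢ Ioo c d := by
  rw [← Icc_prod_Icc]
  exact (Measure.set_prod_ae_eq Ioo_ae_eq_Icc Ioo_ae_eq_Icc).symm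

/-- The divergence theorem on an annulus (on a disk, if `a = 0`). -/
theorem integral_div_annulus {X Y : Plane → ℝ} {a b : ℝ} (ha : 0 ≤ a) (hab : a ≤ b)
    (hX : ContinuousOn X {x | a ≤ ‖x‖ ∧ ‖x‖ ≤ b}) (hY : ContinuousOn Y {x | a ≤ ‖x‖ ∧ ‖x‖ ≤ b})
    (hdX : ∀ x, a < ‖x‖ → ‖x‖ < b → DifferentiableAt ℝ X x)
    (hdY : ∀ x, a < ‖x‖ → ‖x‖ < b → DifferentiableAt ℝ Y x)
    (hi : IntegrableOn (fun x => partialD 0 X x + partialD 1 Y x) {x | a < ‖x‖ ∧ ‖x‖ < b}) :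
    ∫ x in {x : Plane | a < ‖x‖ ∧ ‖x‖ < b}, (partialD 0 X x + partialD 1 Y x)
      = (∫ θ in -Real.pi..Real.pi, b * (Real.cos θ * X (polarPt (b, θ))
          + Real.sin θ * Y (polarPt (b, θ))))
        - ∫ θ in -Real.pi..Real.pi, a * (Real.cos θ * X (polarPt (a, θ))
          + Real.sin θ * Y (polarPt (a, θ))) := by
  -- `f` is `r` times the radial component of the field and `g` its angular component. Then `∂f/∂r +
  -- ∂g/∂θ` is `r` times the divergence, with the Jacobian already included, so the divergence
  -- theorem on a rectangle in `(r, θ)` applies. When `a = 0`, nothing about differentiability at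
  -- the origin is needed.
  set f : ℝ × ℝ → ℝ := fun p => p.1 * (Real.cos p.2 * X (polarPt p) + Real.sin p.2 * Y (polarPt p))
    with hf
  set g : ℝ × ℝ → ℝ := fun p => -Real.sin p.2 * X (polarPt p) + Real.cos p.2 * Y (polarPt p)
    with hg
  have hmaps : MapsTo polarPt (Icc (a, -Real.pi) (b, Real.pi)) {x | a ≤ ‖x‖ ∧ ‖x‖ ≤ b} := by
    intro p hp
    have h1 : a ≤ p.1 := hp.1.1
    have h2 : p.1 ≤ b := hp.2.1
    simp only [mem_ofPred_eq, norm_polarPt, abs_of_nonneg (ha.trans h1)]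
    exact ⟨h1, h2⟩
  have hXc : ContinuousOn (fun p => X (polarPt p)) (Icc (a, -Real.pi) (b, Real.pi)) :=
    hX.comp continuous_polarPt.continuousOn hmaps
  have hYc : ContinuousOn (fun p => Y (polarPt p)) (Icc (a, -Real.pi) (b, Real.pi)) :=
    hY.comp continuous_polarPt.continuousOn hmaps
  have hcos : Continuous fun p : ℝ × ℝ => Real.cos p.2 := by fun_prop
  have hsin : Continuous fun p : ℝ × ℝ => Real.sin p.2 := by fun_prop
  have hcosd : Differentiable ℝ fun p : ℝ × ℝ => Real.cos p.2 := by fun_prop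
  have hsind : Differentiable ℝ fun p : ℝ × ℝ => Real.sin p.2 := by fun_prop
  have hfc : ContinuousOn f (Icc (a, -Real.pi) (b, Real.pi)) :=
    continuous_fst.continuousOn.mul
      ((hcos.continuousOn.mul hXc).add (hsin.continuousOn.mul hYc))
  have hgc : ContinuousOn g (Icc (a, -Real.pi) (b, Real.pi)) :=
    (hsin.neg.continuousOn.mul hXc).add (hcos.continuousOn.mul hYc)
  have hPd : Differentiable ℝ polarPt := by
    intro p
    exact differentiableAt_fst.smul ((hasDerivAt_circlePt p.2).differentiableAt.comp p
      differentiableAt_snd)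
  have hin : ∀ p ∈ Ioo a b ×ˢ Ioo (-Real.pi) Real.pi, a < ‖polarPt p‖ ∧ ‖polarPt p‖ < b := by
    intro p hp
    rw [norm_polarPt, abs_of_pos (ha.trans_lt hp.1.1)]
    exact hp.1
  have hXd : ∀ p ∈ Ioo a b ×ˢ Ioo (-Real.pi) Real.pi,
      DifferentiableAt ℝ (fun p => X (polarPt p)) p := fun p hp =>
    (hdX _ (hin p hp).1 (hin p hp).2).comp p (hPd p)
  have hYd : ∀ p ∈ Ioo a b ×ˢ Ioo (-Real.pi) Real.pi,
      DifferentiableAt ℝ (fun p => Y (polarPt p)) p := fun p hp =>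
    (hdY _ (hin p hp).1 (hin p hp).2).comp p (hPd p)
  have hfd : ∀ p ∈ Ioo a b ×ˢ Ioo (-Real.pi) Real.pi, DifferentiableAt ℝ f p := fun p hp => by
    exact differentiableAt_fst.mul
      ((hcosd p |>.mul (hXd p hp)).add ((hsind p).mul (hYd p hp)))
  have hgd : ∀ p ∈ Ioo a b ×ˢ Ioo (-Real.pi) Real.pi, DifferentiableAt ℝ g p := fun p hp => by
    exact ((hsind p).neg.mul (hXd p hp)).add ((hcosd p).mul (hYd p hp))
  have hdiv : ∀ p ∈ Ioo a b ×ˢ Ioo (-Real.pi) Real.pi,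
      fderiv ℝ f p (1, 0) + fderiv ℝ g p (0, 1)
        = p.1 * (partialD 0 X (polarPt p) + partialD 1 Y (polarPt p)) := by
    rintro ⟨r, θ⟩ hp
    have hX' := (hdX _ (hin _ hp).1 (hin _ hp).2).hasFDerivAt
    have hY' := (hdY _ (hin _ hp).1 (hin _ hp).2).hasFDerivAt
    have hr : HasDerivAt (fun t : ℝ => (t, θ)) (1, 0) r :=
      (hasDerivAt_id r).prodMk (hasDerivAt_const r θ)
    have ht : HasDerivAt (fun t : ℝ => (r, t)) (0, 1) θ :=
      (hasDerivAt_const θ r).prodMk (hasDerivAt_id θ)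
    have hPr : HasDerivAt (fun t : ℝ => polarPt (t, θ)) (circlePt θ) r := by
      simpa [polarPt] using (hasDerivAt_id r).smul_const (circlePt θ)
    have hPt : HasDerivAt (fun t : ℝ => polarPt (r, t))
        (r • (-Real.sin θ • EuclideanSpace.single (0 : Fin 2) (1 : ℝ)
          + Real.cos θ • EuclideanSpace.single 1 1)) θ :=
      (hasDerivAt_circlePt θ).const_smul r
    have hfr := (hfd _ hp).hasFDerivAt.comp_hasDerivAt r hr
    have hgt := (hgd _ hp).hasFDerivAt.comp_hasDerivAt θ ht
    have hfr' := (hasDerivAt_id r).mul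
      (((hX'.comp_hasDerivAt r hPr).const_mul (Real.cos θ)).add
        ((hY'.comp_hasDerivAt r hPr).const_mul (Real.sin θ)))
    have hgt' := ((Real.hasDerivAt_sin θ).neg.mul (hX'.comp_hasDerivAt θ hPt)).add
      ((Real.hasDerivAt_cos θ).mul (hY'.comp_hasDerivAt θ hPt))
    rw [hfr.unique hfr', hgt.unique hgt']
    have hD : ∀ (h : Plane → ℝ) (i : Fin 2) (x : Plane),
        fderiv ℝ h x (EuclideanSpace.single i 1) = partialD i h x := fun _ _ _ => rfl
    simp only [hD, fderiv_circlePt, Function.comp_apply, map_add, map_smul, smul_eq_mul, id,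
      Pi.neg_apply, Pi.add_apply]
    linear_combination (r * partialD 0 X (polarPt (r, θ)) + r * partialD 1 Y (polarPt (r, θ)))
      * Real.sin_sq_add_cos_sq θ
  have hae := Icc_prod_ae_eq_Ioo a b (-Real.pi) Real.pi
  have hmeas : MeasurableSet (Ioo a b ×ˢ Ioo (-Real.pi) Real.pi) :=
    measurableSet_Ioo.prod measurableSet_Ioo
  have hint := integral_divergence_prod_Icc_of_hasFDerivAt_off_countable_of_le f g
    (fderiv ℝ f) (fderiv ℝ g) (a, -Real.pi) (b, Real.pi)
    ⟨hab, by linarith [Real.pi_pos] ⟩ ∅ countable_empty hfc hgc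
    (fun p hp => (hfd p hp.1).hasFDerivAt) (fun p hp => (hgd p hp.1).hasFDerivAt)
    ((integrableOn_congr_set_ae hae).2 ((integrableOn_annulus_polarPt ha hi).congr_fun
      (fun p hp => (hdiv p hp).symm) hmeas))
  rw [setIntegral_congr_set hae, setIntegral_congr_fun hmeas hdiv,
    setIntegral_annulus_eq ha fun x => partialD 0 X x + partialD 1 Y x] at hint
  rw [hint]
  -- The sides `θ = ±π` are mapped to the same segment, so their contributions cancel.
  have h0 : ∀ r, g (r, Real.pi) = g (r, -Real.pi) := by
    intro r
    have : polarPt (r, Real.pi) = polarPt (r, -Real.pi) := by simp [polarPt, circlePt]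
    simp [hg, this]
  simp only [h0, hf]
  ring

/-! ### The exterior domain and the divergence theorem without a term at infinity -/

theorem northInterior_eq : northInterior = {x : Plane | 1 < ‖x‖} := by
  ext x; simp [northInterior]

theorem northDomain_eq : northDomain = {x : Plane | 1 ≤ ‖x‖} := by
  ext x; simp [northDomain, unitDisk]

theorem isOpen_northInterior : IsOpen northInterior := Metric.isClosed_closedBall.isOpen_compl

theorem northInterior_subset : northInterior ⊆ northDomain := by
  rw [northInterior_eq, northDomain_eq]
  exact fun x hx => le_of_lt (show 1 < ‖x‖ from hx)

theorem northDomain_ae_eq : (northDomain : Set Plane) =ᵐ[volume] northInterior := by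
  have h : northDomain \ northInterior ⊆ Metric.sphere (0 : Plane) 1 := by
    intro x hx
    simp only [northInterior_eq, northDomain_eq, Set.mem_sdiff, mem_ofPred_eq, not_lt] at hx
    simpa using le_antisymm hx.2 hx.1
  refine (ae_eq_set.2 ⟨measure_mono_null h (Measure.addHaar_sphere volume _ _), ?_⟩)
  rw [sdiff_eq_empty.2 northInterior_subset, measure_empty]

theorem integrableOn_northInterior_polarPt {f : Plane → ℝ} (hf : IntegrableOn f northInterior) :
    IntegrableOn (fun p => p.1 * f (polarPt p)) (Ioi 1 ×ˢ Ioo (-Real.pi) Real.pi) := by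
  have hm := isOpen_northInterior.measurableSet
  have hm' := continuous_polarPt.measurable hm
  have h := integrableOn_polarPt (hf.integrable_indicator hm)
  rw [mul_indicator_polarPt, IntegrableOn, integrable_indicator_iff hm', IntegrableOn,
    Measure.restrict_restrict hm'] at h
  refine IntegrableOn.mono_set h ?_
  rintro ⟨r, θ⟩ ⟨hr, hθ⟩
  have hr' : (0 : ℝ) < r := zero_lt_one.trans hr
  refine ⟨?_, hr', hθ⟩
  simp only [mem_preimage, northInterior_eq, mem_ofPred_eq, norm_polarPt]
  rwa [abs_of_pos hr']

/-- The flux of the vector field `(X, Y)` through the circle of radius `r`. -/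
noncomputable def flux (X Y : Plane → ℝ) (r : ℝ) : ℝ :=
  ∫ θ in -Real.pi..Real.pi, r * (Real.cos θ * X (polarPt (r, θ)) + Real.sin θ * Y (polarPt (r, θ)))

/-- Cauchy–Schwarz on the circle of radius `r`, with the radial component bounded by the length of
the field. The factor `r⁻¹` is arranged so that the right side is the polar density of the `L²`
norm. -/
theorem sq_integral_circle_le {x y : ℝ → ℝ} (hx : Continuous x) (hy : Continuous y) {r : ℝ}
    (hr : 0 < r) :
    (∫ θ in -Real.pi..Real.pi, r * (Real.cos θ * x θ + Real.sin θ * y θ)) ^ 2 * r⁻¹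
      ≤ 2 * Real.pi * ∫ θ in -Real.pi..Real.pi, r * (x θ ^ 2 + y θ ^ 2) := by
  have hpi := Real.pi_pos
  have hle : -Real.pi ≤ Real.pi := by linarith
  set B := ∫ θ in -Real.pi..Real.pi, r * (Real.cos θ * x θ + Real.sin θ * y θ) with hB
  -- `m` is the mean over the circle; integrating `(integrand - m)² ≥ 0` yields Cauchy–Schwarz.
  set m := B / (2 * Real.pi) with hm
  have key : ∫ θ in -Real.pi..Real.pi, (2 * m *
      (r * (Real.cos θ * x θ + Real.sin θ * y θ)) - m ^ 2)
      ≤ ∫ θ in -Real.pi..Real.pi, r * (r * (x θ ^ 2 + y θ ^ 2)) := by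
    refine intervalIntegral.integral_mono_on hle
      (Continuous.intervalIntegrable (by fun_prop) _ _)
      (Continuous.intervalIntegrable (by fun_prop) _ _) fun θ _ => ?_
    generalize x θ = x
    generalize y θ = y
    have h1 := sq_nonneg (r * (Real.cos θ * x + Real.sin θ * y) - m)
    have h2 : r ^ 2 * (x ^ 2 + y ^ 2) - (r * (Real.cos θ * x + Real.sin θ * y)) ^ 2
        = r ^ 2 * (Real.sin θ * x - Real.cos θ * y) ^ 2 := by
      linear_combination (-(r ^ 2 * (x ^ 2 + y ^ 2))) * Real.sin_sq_add_cos_sq θ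
    have h3 : 0 ≤ r ^ 2 * (Real.sin θ * x - Real.cos θ * y) ^ 2 := by positivity
    linarith
  rw [intervalIntegral.integral_sub (Continuous.intervalIntegrable (by fun_prop) _ _)
    (Continuous.intervalIntegrable (by fun_prop) _ _),
    intervalIntegral.integral_const_mul (2 * m), ← hB,
    intervalIntegral.integral_const_mul r, intervalIntegral.integral_const] at key
  set G := ∫ θ in -Real.pi..Real.pi, r * (x θ ^ 2 + y θ ^ 2)
  have e : 2 * m * B - (Real.pi - -Real.pi) • m ^ 2 = B ^ 2 / (2 * Real.pi) := by
    rw [hm, smul_eq_mul]; field_simp; ring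
  rw [e, div_le_iff₀ (by positivity)] at key
  rw [mul_inv_le_iff₀ hr]
  linarith

theorem flux_sq_le {X Y : Plane → ℝ} (hX : ContinuousOn X northDomain)
    (hY : ContinuousOn Y northDomain) {r : ℝ} (hr : 1 ≤ r) :
    flux X Y r ^ 2 * r⁻¹ ≤ 2 * Real.pi *
      ∫ θ in Ioo (-Real.pi) Real.pi, r * (X (polarPt (r, θ)) ^ 2 + Y (polarPt (r, θ)) ^ 2) := by
  have hmem : ∀ θ, polarPt (r, θ) ∈ northDomain := fun θ => by
    rw [northDomain_eq, mem_ofPred_eq, norm_polarPt]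
    exact hr.trans (le_abs_self r)
  have hpc : Continuous fun θ => polarPt (r, θ) := continuous_polarPt.comp (by fun_prop)
  rw [← integral_Ioc_eq_integral_Ioo,
    ← intervalIntegral.integral_of_le (by linarith [Real.pi_pos])]
  exact sq_integral_circle_le (hX.comp_continuous hpc hmem) (hY.comp_continuous hpc hmem)
    (by linarith)

/-- The divergence theorem on `{1 < |x|}`, for square integrable vector fields. -/
theorem integral_div_northInterior {X Y : Plane → ℝ}
    (hX : ContinuousOn X northDomain) (hY : ContinuousOn Y northDomain)
    (hdX : ∀ x ∈ northInterior, DifferentiableAt ℝ X x)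
    (hdY : ∀ x ∈ northInterior, DifferentiableAt ℝ Y x)
    (hi : IntegrableOn (fun x => partialD 0 X x + partialD 1 Y x) northInterior)
    (h2 : IntegrableOn (fun x => X x ^ 2 + Y x ^ 2) northInterior) :
    ∫ x in northInterior, (partialD 0 X x + partialD 1 Y x) = -flux X Y 1 := by
  set d := fun x => partialD 0 X x + partialD 1 Y x with hd
  have hsub : ∀ R : ℝ, {x : Plane | 1 < ‖x‖ ∧ ‖x‖ < R} ⊆ northInterior := fun R x hx => by
    rw [northInterior_eq]; exact hx.1
  have hK : ∀ R : ℝ, {x : Plane | 1 ≤ ‖x‖ ∧ ‖x‖ ≤ R} ⊆ northDomain := fun R x hx => by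
    rw [northDomain_eq]; exact hx.1
  have hann : ∀ R : ℝ, 1 ≤ R →
      (∫ x in {x : Plane | 1 < ‖x‖ ∧ ‖x‖ < R}, d x) + flux X Y 1 = flux X Y R := by
    intro R hR
    rw [hd, integral_div_annulus zero_le_one hR (hX.mono (hK R)) (hY.mono (hK R))
      (fun x hx _ => hdX x (northInterior_eq ▸ hx)) (fun x hx _ => hdY x (northInterior_eq ▸ hx))
      (hi.mono_set (hsub R))]
    simp only [flux]
    ring
  have hU : ⋃ R : ℝ, {x : Plane | 1 < ‖x‖ ∧ ‖x‖ < R} = northInterior := by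
    refine subset_antisymm (iUnion_subset hsub) fun x hx => mem_iUnion.2 ⟨‖x‖ + 1, ?_, by simp⟩
    rwa [northInterior_eq] at hx
  have hlim : Tendsto (flux X Y) atTop (𝓝 ((∫ x in northInterior, d x) + flux X Y 1)) := by
    have h := tendsto_setIntegral_of_monotone (μ := volume) (f := d)
      (s := fun R : ℝ => {x : Plane | 1 < ‖x‖ ∧ ‖x‖ < R})
      (fun R => (isOpen_annulus 1 R).measurableSet)
      (fun R S hRS x hx => ⟨hx.1, hx.2.trans_le hRS⟩) (by rw [hU]; exact hi)
    rw [hU] at h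
    refine (h.add_const (flux X Y 1)).congr' ?_
    filter_upwards [eventually_ge_atTop 1] with R hR using hann R hR
  set L := (∫ x in northInterior, d x) + flux X Y 1 with hL
  -- The flux tends to `L` as the radius grows. If `L ≠ 0`, then `flux² > L² / 2` beyond some `R₀`,
  -- and `flux_sq_le` bounds `1 / r` there by a constant times the integrable function of `hG`,
  -- which is impossible.
  suffices L = 0 by linarith
  by_contra hL0
  have hL2 : 0 < L ^ 2 := by positivity
  have hev : ∀ᶠ R in atTop, L ^ 2 / 2 < flux X Y R ^ 2 :=
    (hlim.pow 2).eventually_const_lt (by linarith)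
  obtain ⟨R₀, hR₀⟩ := eventually_atTop.1 (hev.and (eventually_ge_atTop 1))
  have hG : IntegrableOn (fun r => ∫ θ in Ioo (-Real.pi) Real.pi,
      r * (X (polarPt (r, θ)) ^ 2 + Y (polarPt (r, θ)) ^ 2)) (Ioi 1) := by
    have h := integrableOn_northInterior_polarPt h2
    rw [IntegrableOn, Measure.volume_eq_prod, ← Measure.prod_restrict] at h
    exact h.integral_prod_left
  have hG' := (hG.mono_set (Ioi_subset_Ioi (hR₀ R₀ le_rfl).2)).const_mul
    (2 * Real.pi * (2 / L ^ 2))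
  refine not_integrableOn_Ioi_inv (a := R₀) (hG'.mono' measurable_inv.aestronglyMeasurable ?_)
  refine (ae_restrict_mem measurableSet_Ioi).mono fun r hr => ?_
  obtain ⟨h3, h4⟩ := hR₀ r (le_of_lt hr)
  have h5 := flux_sq_le hX hY h4
  have hr0 : 0 < r⁻¹ := inv_pos.2 (by linarith)
  rw [Real.norm_of_nonneg hr0.le]
  set G := ∫ θ in Ioo (-Real.pi) Real.pi, r * (X (polarPt (r, θ)) ^ 2 + Y (polarPt (r, θ)) ^ 2)
  have h6 : L ^ 2 / 2 * r⁻¹ ≤ 2 * Real.pi * G :=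
    (mul_le_mul_of_nonneg_right h3.le hr0.le).trans h5
  calc r⁻¹ = 2 / L ^ 2 * (L ^ 2 / 2 * r⁻¹) := by field_simp
    _ ≤ 2 / L ^ 2 * (2 * Real.pi * G) := by gcongr
    _ = _ := by ring

/-! ### Derivatives and integrands in complex notation -/

/-- The partial derivative of a complex valued function. -/
noncomputable def cD (i : Fin 2) (z : Plane → ℂ) (x : Plane) : ℂ :=
  fderiv ℝ z x (EuclideanSpace.single i 1)

/-- The Laplacian of a complex valued function, in coordinates. -/
noncomputable def cLap (z : Plane → ℂ) (x : Plane) : ℂ :=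
  cD 0 (cD 0 z) x + cD 1 (cD 1 z) x

theorem gradient_apply (f : Plane → ℝ) (x : Plane) (i : Fin 2) :
    gradient f x i = partialD i f x := by
  have h : inner ℝ (gradient f x) (EuclideanSpace.single i (1 : ℝ)) = partialD i f x := by
    rw [inner_gradient_left]; rfl
  rw [← h, EuclideanSpace.inner_single_right]
  simp

theorem inner_gradient_eq (f g : Plane → ℝ) (x : Plane) :
    inner ℝ (gradient f x) (gradient g x)
      = partialD 0 f x * partialD 0 g x + partialD 1 f x * partialD 1 g x := by
  rw [PiLp.inner_apply, Fin.sum_univ_two]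
  simp only [gradient_apply]
  simp [mul_comm]

theorem norm_gradient_sq (f : Plane → ℝ) (x : Plane) :
    ‖gradient f x‖ ^ 2 = partialD 0 f x ^ 2 + partialD 1 f x ^ 2 := by
  rw [← real_inner_self_eq_norm_sq, inner_gradient_eq]
  ring

theorem partialD_uPart {z : Plane → ℂ} {x : Plane} (hz : DifferentiableAt ℝ z x) (i : Fin 2) :
    partialD i (uPart z) x = (cD i z x).re := by
  have h := (Complex.reCLM.hasFDerivAt.comp x hz.hasFDerivAt).fderiv
  have e : uPart z = Complex.reCLM ∘ z := rfl
  rw [partialD, e, h]; rfl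

theorem partialD_vPart {z : Plane → ℂ} {x : Plane} (hz : DifferentiableAt ℝ z x) (i : Fin 2) :
    partialD i (vPart z) x = (cD i z x).im := by
  have h := (Complex.imCLM.hasFDerivAt.comp x hz.hasFDerivAt).fderiv
  have e : vPart z = Complex.imCLM ∘ z := rfl
  rw [partialD, e, h]; rfl

theorem gradSq_eq {z : Plane → ℂ} {x : Plane} (hz : DifferentiableAt ℝ z x) :
    gradSq z x = ‖cD 0 z x‖ ^ 2 + ‖cD 1 z x‖ ^ 2 := by
  simp only [gradSq, norm_gradient_sq, partialD_uPart hz, partialD_vPart hz, Complex.sq_norm,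
    Complex.normSq_apply]
  ring

theorem contDiffAt_cD {z : Plane → ℂ} {x : Plane} (hz : ContDiffAt ℝ 2 z x) (i : Fin 2) :
    ContDiffAt ℝ 1 (cD i z) x :=
  (hz.fderiv_right (m := 1) (by norm_num)).clm_apply contDiffAt_const

theorem laplacian_eq_cLap {z : Plane → ℂ} {x : Plane} (hz : ContDiffAt ℝ 2 z x) :
    Laplacian.laplacian z x = cLap z x := by
  have hd : DifferentiableAt ℝ (fderiv ℝ z) x :=
    (hz.fderiv_right (m := 1) (by norm_num)).differentiableAt (by norm_num)
  have h : ∀ i : Fin 2, cD i (cD i z) x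
      = fderiv ℝ (fderiv ℝ z) x (EuclideanSpace.single i 1) (EuclideanSpace.single i 1) := by
    intro i
    have := (hd.hasFDerivAt.clm_apply
      (hasFDerivAt_const (EuclideanSpace.single i (1 : ℝ)) x)).fderiv
    rw [cD, show cD i z = fun y => fderiv ℝ z y (EuclideanSpace.single i 1) from rfl, this]
    simp
  rw [InnerProductSpace.laplacian_eq_iteratedFDeriv_orthonormalBasis z
    (EuclideanSpace.basisFun (Fin 2) ℝ)]
  simp [iteratedFDeriv_two_apply, Fin.sum_univ_two, cLap, h]

theorem laplacian_uPart {z : Plane → ℂ} {x : Plane} (hz : ContDiffAt ℝ 2 z x) :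
    Laplacian.laplacian (uPart z) x = (cLap z x).re := by
  rw [← laplacian_eq_cLap hz]
  exact hz.laplacian_CLM_comp_left (l := Complex.reCLM)

theorem laplacian_vPart {z : Plane → ℂ} {x : Plane} (hz : ContDiffAt ℝ 2 z x) :
    Laplacian.laplacian (vPart z) x = (cLap z x).im := by
  rw [← laplacian_eq_cLap hz]
  exact hz.laplacian_CLM_comp_left (l := Complex.imCLM)

/-- The Euler–Lagrange equation in complex notation. -/
def ComplexEL (z : Plane → ℂ) (x : Plane) : Prop :=
  cLap z x * (1 + ‖z x‖ ^ 2 : ℝ)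
    = 2 * (starRingEnd ℂ) (z x) * (cD 0 z x ^ 2 + cD 1 z x ^ 2)

theorem one_add_sq_pos (z : ℂ) : 0 < 1 + ‖z‖ ^ 2 := by positivity

theorem eulerLagrangeAt_iff {z : Plane → ℂ} {x : Plane} (hz : ContDiffAt ℝ 2 z x) :
    EulerLagrangeAt (uPart z) (vPart z) x ↔ ComplexEL z x := by
  have hd := hz.differentiableAt (by norm_num)
  have hN : (1 + uPart z x ^ 2 + vPart z x ^ 2 : ℝ) = 1 + ‖z x‖ ^ 2 := by
    rw [Complex.sq_norm, Complex.normSq_apply, uPart, vPart]; ring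
  have hN0 := one_add_sq_pos (z x)
  rw [EulerLagrangeAt, ComplexEL, hN, eq_div_iff hN0.ne', eq_div_iff hN0.ne', laplacian_uPart hz,
    laplacian_vPart hz, Complex.ext_iff]
  simp only [partialD_uPart hd, partialD_vPart hd, uPart, vPart, Complex.mul_re, Complex.mul_im,
    Complex.add_re, Complex.add_im, Complex.ofReal_re, Complex.ofReal_im, Complex.conj_re,
    Complex.conj_im, Complex.re_ofNat, Complex.im_ofNat, pow_two]
  constructor
  · rintro ⟨h1, h2⟩
    constructor
    · linear_combination -h1
    · linear_combination -h2
  · rintro ⟨h1, h2⟩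
    constructor
    · linear_combination -h1
    · linear_combination -h2

/-- A directional derivative is computed along the line. -/
theorem fderiv_apply_eq {F : Type*} [NormedAddCommGroup F] [NormedSpace ℝ F] {f : Plane → F}
    {x v : Plane} {f' : F} (hf : DifferentiableAt ℝ f x)
    (h : HasDerivAt (fun t : ℝ => f (x + t • v)) f' 0) : fderiv ℝ f x v = f' :=
  HasDerivAt.unique (hf.hasFDerivAt.hasLineDerivAt v) h

theorem hasDerivAt_line {z : Plane → ℂ} {x : Plane} (hz : DifferentiableAt ℝ z x) (i : Fin 2) :
    HasDerivAt (fun t : ℝ => z (x + t • EuclideanSpace.single i (1 : ℝ))) (cD i z x) 0 :=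
  hz.hasFDerivAt.hasLineDerivAt _

theorem hasDerivAt_line_normSq {z : Plane → ℂ} {x : Plane} (hz : DifferentiableAt ℝ z x)
    (i : Fin 2) :
    HasDerivAt (fun t : ℝ => ‖z (x + t • EuclideanSpace.single i (1 : ℝ))‖ ^ 2)
      (2 * ((starRingEnd ℂ) (z x) * cD i z x).re) 0 := by
  have h := (hasDerivAt_line hz i).norm_sq
  simp only [zero_smul, add_zero] at h
  convert h using 2
  rw [Complex.inner, mul_comm]

theorem inner_gradient_combination (f g h : Plane → ℝ) (x : Plane) (a b : ℝ) :
    inner ℝ (gradient f x) (a • gradient g x + b • gradient h x)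
      = partialD 0 f x * (a * partialD 0 g x + b * partialD 0 h x)
        + partialD 1 f x * (a * partialD 1 g x + b * partialD 1 h x) := by
  rw [inner_add_right, inner_smul_right, inner_smul_right, inner_gradient_eq, inner_gradient_eq]
  ring

/-- `⟨z, ∂ᵢ z⟩`. -/
noncomputable def radD (i : Fin 2) (z : Plane → ℂ) (x : Plane) : ℝ :=
  ((starRingEnd ℂ) (z x) * cD i z x).re

theorem radD_eq (i : Fin 2) (z : Plane → ℂ) (x : Plane) :
    radD i z x = (z x).re * (cD i z x).re + (z x).im * (cD i z x).im := by
  simp [radD]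

theorem differentiableAt_normSq {z : Plane → ℂ} {x : Plane} (hz : DifferentiableAt ℝ z x) :
    DifferentiableAt ℝ (fun y => ‖z y‖ ^ 2) x := hz.norm_sq ℝ

theorem partialD_weight {z : Plane → ℂ} {x : Plane} (hz : DifferentiableAt ℝ z x) (i : Fin 2) :
    partialD i (fun y => 2 / (1 + ‖z y‖ ^ 2) ^ 2) x = -8 * radD i z x / (1 + ‖z x‖ ^ 2) ^ 3 := by
  have hN := one_add_sq_pos (z x)
  refine fderiv_apply_eq ?_ ?_
  · have h1 : DifferentiableAt ℝ (fun y => (1 + ‖z y‖ ^ 2) ^ 2) x :=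
      ((differentiableAt_normSq hz).const_add 1).fun_pow 2
    have h2 : (1 + ‖z x‖ ^ 2) ^ 2 ≠ 0 := by positivity
    simpa only [div_eq_mul_inv] using (h1.fun_inv h2).const_mul 2
  · have h1 := ((hasDerivAt_line_normSq hz i).const_add 1).fun_pow 2
    have h := (hasDerivAt_const (0 : ℝ) (2 : ℝ)).fun_div h1
      (by positivity)
    refine h.congr_deriv ?_
    simp only [zero_smul, add_zero, radD]
    field_simp
    simp
    ring

theorem partialD_log {z : Plane → ℂ} {x : Plane} (hz : DifferentiableAt ℝ z x) (i : Fin 2) :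
    partialD i (fun y => Real.log (1 + ‖z y‖ ^ 2)) x = 2 * radD i z x / (1 + ‖z x‖ ^ 2) := by
  have hN := one_add_sq_pos (z x)
  refine fderiv_apply_eq ?_ ?_
  · exact ((differentiableAt_normSq hz).const_add 1).log hN.ne'
  · have h := ((hasDerivAt_line_normSq hz i).const_add 1).log
      (by simp only [zero_smul, add_zero]; positivity)
    refine h.congr_deriv ?_
    simp only [zero_smul, add_zero, radD]

theorem energyDensity_eq {z : Plane → ℂ} {x : Plane} (hz : DifferentiableAt ℝ z x) :
    energyDensity z x = 2 * (‖cD 0 z x‖ ^ 2 + ‖cD 1 z x‖ ^ 2) / (1 + ‖z x‖ ^ 2) ^ 2 := by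
  rw [energyDensity, gradSq_eq hz]

theorem partsFirst_eq {z : Plane → ℂ} {x : Plane} (hz : DifferentiableAt ℝ z x) :
    partsFirst z x = -8 * (radD 0 z x ^ 2 + radD 1 z x ^ 2) / (1 + ‖z x‖ ^ 2) ^ 3 := by
  rw [partsFirst, inner_gradient_combination]
  simp only [partialD_weight hz, partialD_uPart hz, partialD_vPart hz, uPart, vPart, ← radD_eq]
  ring

theorem partsSecond_eq {z : Plane → ℂ} {x : Plane} (hz : ContDiffAt ℝ 2 z x) :
    partsSecond z x
      = 2 * ((starRingEnd ℂ) (z x) * cLap z x).re / (1 + ‖z x‖ ^ 2) ^ 2 := by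
  rw [partsSecond, laplacian_uPart hz, laplacian_vPart hz]
  simp [uPart, vPart]

/-- Multiplying the equation by `conj z` trades the Laplacian for first derivatives. Both the
decomposition and the convergence of this integral rest on that. -/
theorem partsSecond_eq_of_EL {z : Plane → ℂ} {x : Plane} (hz : ContDiffAt ℝ 2 z x)
    (h : ComplexEL z x) :
    partsSecond z x = 4 * ((starRingEnd ℂ) (z x) ^ 2 * (cD 0 z x ^ 2 + cD 1 z x ^ 2)).re
      / (1 + ‖z x‖ ^ 2) ^ 3 := by
  have hN := one_add_sq_pos (z x)
  rw [partsSecond_eq hz, div_eq_div_iff (by positivity) (by positivity)]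
  have h2 : ((starRingEnd ℂ) (z x) * cLap z x).re * (1 + ‖z x‖ ^ 2)
      = 2 * ((starRingEnd ℂ) (z x) ^ 2 * (cD 0 z x ^ 2 + cD 1 z x ^ 2)).re := by
    rw [← Complex.re_mul_ofReal, mul_assoc, h, ← Complex.re_ofReal_mul]
    congr 1; push_cast; ring
  linear_combination 2 * (1 + ‖z x‖ ^ 2) ^ 2 * h2

theorem logTerm_eq {z : Plane → ℂ} {x : Plane} (hz : DifferentiableAt ℝ z x) :
    logTerm z x = 4 * (radD 0 z x ^ 2 + radD 1 z x ^ 2) / (1 + ‖z x‖ ^ 2) ^ 3 := by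
  have hN := one_add_sq_pos (z x)
  rw [logTerm, norm_gradient_sq]
  simp only [partialD_log hz]
  field_simp
  ring

theorem gradTerm_eq (z : Plane → ℂ) (x : Plane) : gradTerm z x = 2 * energyDensity z x := by
  rw [gradTerm, energyDensity]; ring

/-- The imaginary part of `conj z * ∂ᵢ z`. -/
noncomputable def angD (i : Fin 2) (z : Plane → ℂ) (x : Plane) : ℝ :=
  ((starRingEnd ℂ) (z x) * cD i z x).im

theorem angD_eq (i : Fin 2) (z : Plane → ℂ) (x : Plane) :
    angD i z x = (z x).re * (cD i z x).im - (z x).im * (cD i z x).re := by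
  simp [angD]; ring

theorem crossTerm_eq {z : Plane → ℂ} {x : Plane} (hz : DifferentiableAt ℝ z x) :
    crossTerm z x = 4 * (angD 0 z x ^ 2 + angD 1 z x ^ 2) / (1 + ‖z x‖ ^ 2) ^ 3 := by
  have hN := one_add_sq_pos (z x)
  rw [crossTerm, norm_gradient_sq, norm_gradient_sq, inner_gradient_eq]
  simp only [partialD_uPart hz, partialD_vPart hz, uPart, vPart, angD_eq]
  field_simp
  ring

/-- `radD` and `angD` are the real and imaginary parts of `conj z ∂ᵢ z`, hence this is its squared
modulus. It splits the gradient into motion along meridians and motion around the pole. -/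
theorem radD_sq_add_angD_sq (i : Fin 2) (z : Plane → ℂ) (x : Plane) :
    radD i z x ^ 2 + angD i z x ^ 2 = ‖z x‖ ^ 2 * ‖cD i z x‖ ^ 2 := by
  rw [radD_eq, angD_eq, Complex.sq_norm, Complex.sq_norm, Complex.normSq_apply,
    Complex.normSq_apply]
  ring

theorem re_conj_sq_mul_sq (i : Fin 2) (z : Plane → ℂ) (x : Plane) :
    ((starRingEnd ℂ) (z x) ^ 2 * cD i z x ^ 2).re = radD i z x ^ 2 - angD i z x ^ 2 := by
  rw [← mul_pow, sq, Complex.mul_re, radD, angD]; ring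

/-! ### The vector field behind the integration by parts -/

/-- The coordinates of the vector field `2 ⟨z, ∇z⟩ / (1 + |z|²)²`, with derivatives taken from
inside `K`. -/
noncomputable def fluxField (K : Set Plane) (i : Fin 2) (z : Plane → ℂ) (x : Plane) : ℝ :=
  2 * ((starRingEnd ℂ) (z x) * fderivWithin ℝ z K x (EuclideanSpace.single i 1)).re
    / (1 + ‖z x‖ ^ 2) ^ 2

theorem circleTerm_eq_flux (K : Set Plane) (z : Plane → ℂ) :
    circleTerm K z = flux (fluxField K 0 z) (fluxField K 1 z) 1 := by
  have hper : Function.Periodic (fun θ => 2 * inner ℝ (z (circlePt θ))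
      (fderivWithin ℝ z K (circlePt θ) (circlePt θ)) / (1 + ‖z (circlePt θ)‖ ^ 2) ^ 2)
      (2 * Real.pi) := by
    intro θ
    have : circlePt (θ + 2 * Real.pi) = circlePt θ := by simp [circlePt]
    simp only [this]
  have h := hper.intervalIntegral_add_eq 0 (-Real.pi)
  rw [zero_add, show -Real.pi + 2 * Real.pi = Real.pi by ring] at h
  rw [circleTerm, h, flux]
  refine intervalIntegral.integral_congr fun θ _ => ?_
  have hp : polarPt (1, θ) = circlePt θ := by simp [polarPt]
  have hc : fderivWithin ℝ z K (circlePt θ) (circlePt θ)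
      = Real.cos θ • fderivWithin ℝ z K (circlePt θ) (EuclideanSpace.single 0 1)
        + Real.sin θ • fderivWithin ℝ z K (circlePt θ) (EuclideanSpace.single 1 1) := by
    rw [← map_smul, ← map_smul, ← map_add, ← circlePt_eq]
  simp only [hp, hc, fluxField, Complex.inner, Complex.add_re, Complex.mul_re, Complex.conj_re,
    Complex.conj_im, Complex.smul_re, Complex.smul_im, Complex.add_im, smul_eq_mul]
  ring

theorem continuousOn_fderivWithin_apply {z : Plane → ℂ} {K : Set Plane} (hK : UniqueDiffOn ℝ K)
    (hz : ContDiffOn ℝ 2 z K) (v : Plane) : ContDiffOn ℝ 1 (fun x => fderivWithin ℝ z K x v) K :=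
  (hz.fderivWithin hK (by norm_num)).clm_apply contDiffOn_const

theorem continuousOn_one_add_normSq {z : Plane → ℂ} {K : Set Plane} (hz : ContinuousOn z K) :
    ContinuousOn (fun x => 1 + ‖z x‖ ^ 2) K := by fun_prop

theorem continuousOn_fluxField {z : Plane → ℂ} {K : Set Plane} (hK : UniqueDiffOn ℝ K)
    (hz : ContDiffOn ℝ 2 z K) (i : Fin 2) : ContinuousOn (fluxField K i z) K := by
  have h1 := (continuousOn_fderivWithin_apply hK hz (EuclideanSpace.single i 1)).continuousOn
  have h2 := hz.continuousOn
  have h3 : ContinuousOn (fun x => (starRingEnd ℂ) (z x)) K :=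
    Complex.continuous_conj.comp_continuousOn h2
  have h4 : ContinuousOn (fun x => ((starRingEnd ℂ) (z x)
      * fderivWithin ℝ z K x (EuclideanSpace.single i 1)).re) K :=
    Complex.continuous_re.comp_continuousOn (h3.mul h1)
  exact (continuousOn_const.mul h4).div ((continuousOn_one_add_normSq h2).pow 2)
    fun x _ => (pow_pos (one_add_sq_pos (z x)) 2).ne'

theorem fluxField_eq {z : Plane → ℂ} {K : Set Plane} {x : Plane} (hx : K ∈ 𝓝 x) (i : Fin 2) :
    fluxField K i z x = 2 * radD i z x / (1 + ‖z x‖ ^ 2) ^ 2 := by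
  rw [fluxField, fderivWithin_of_mem_nhds hx, radD, cD]

theorem fluxField_eventuallyEq {z : Plane → ℂ} {K : Set Plane} {x : Plane} (hx : K ∈ 𝓝 x)
    (i : Fin 2) :
    fluxField K i z =ᶠ[𝓝 x] fun y => 2 * radD i z y / (1 + ‖z y‖ ^ 2) ^ 2 := by
  filter_upwards [eventually_mem_nhds_iff.2 hx] with y hy using fluxField_eq hy i

theorem hasDerivAt_line_radD {z : Plane → ℂ} {x : Plane} (hz : ContDiffAt ℝ 2 z x) (i : Fin 2) :
    HasDerivAt (fun t : ℝ => radD i z (x + t • EuclideanSpace.single i (1 : ℝ)))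
      (‖cD i z x‖ ^ 2 + ((starRingEnd ℂ) (z x) * cD i (cD i z) x).re) 0 := by
  have hd := hz.differentiableAt (by norm_num)
  have hd' := (contDiffAt_cD hz i).differentiableAt (by norm_num)
  have h1 := (Complex.conjCLE.toContinuousLinearMap.hasFDerivAt).comp_hasDerivAt (0 : ℝ)
    (hasDerivAt_line hd i)
  have h2 := (h1.mul (hasDerivAt_line hd' i))
  have h3 := Complex.reCLM.hasFDerivAt.comp_hasDerivAt (0 : ℝ) h2
  refine h3.congr_deriv ?_
  rw [Complex.sq_norm, Complex.normSq_apply]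
  simp

theorem differentiableAt_radD {z : Plane → ℂ} {x : Plane} (hz : ContDiffAt ℝ 2 z x) (i : Fin 2) :
    DifferentiableAt ℝ (radD i z) x := by
  have hd := hz.differentiableAt (by norm_num)
  have hd' := (contDiffAt_cD hz i).differentiableAt (by norm_num)
  have h1 : DifferentiableAt ℝ (fun y => (starRingEnd ℂ) (z y)) x :=
    Complex.conjCLE.toContinuousLinearMap.differentiableAt.comp x hd
  exact Complex.reCLM.differentiableAt.comp x (h1.mul hd')

theorem differentiableAt_weighted_radD {z : Plane → ℂ} {x : Plane} (hz : ContDiffAt ℝ 2 z x)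
    (i : Fin 2) :
    DifferentiableAt ℝ (fun y => 2 * radD i z y / (1 + ‖z y‖ ^ 2) ^ 2) x := by
  have h0 := differentiableAt_radD hz i
  have h1 : DifferentiableAt ℝ (fun y => (1 + ‖z y‖ ^ 2) ^ 2) x :=
    ((differentiableAt_normSq (hz.differentiableAt (by norm_num))).const_add 1).fun_pow 2
  have h2 : (1 + ‖z x‖ ^ 2) ^ 2 ≠ 0 := (pow_pos (one_add_sq_pos (z x)) 2).ne'
  simpa only [div_eq_mul_inv] using (h0.const_mul 2).fun_mul (h1.fun_inv h2)

theorem differentiableAt_fluxField {z : Plane → ℂ} {K : Set Plane} {x : Plane} (hx : K ∈ 𝓝 x)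
    (hz : ContDiffAt ℝ 2 z x) (i : Fin 2) : DifferentiableAt ℝ (fluxField K i z) x :=
  (differentiableAt_weighted_radD hz i).congr_of_eventuallyEq (fluxField_eventuallyEq hx i)

theorem partialD_fluxField {z : Plane → ℂ} {K : Set Plane} {x : Plane} (hx : K ∈ 𝓝 x)
    (hz : ContDiffAt ℝ 2 z x) (i : Fin 2) :
    partialD i (fluxField K i z) x
      = 2 * (‖cD i z x‖ ^ 2 + ((starRingEnd ℂ) (z x) * cD i (cD i z) x).re) / (1 + ‖z x‖ ^ 2) ^ 2
        - 8 * radD i z x ^ 2 / (1 + ‖z x‖ ^ 2) ^ 3 := by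
  have hN := one_add_sq_pos (z x)
  rw [partialD, (fluxField_eventuallyEq hx i).fderiv_eq]
  refine fderiv_apply_eq (differentiableAt_weighted_radD hz i) ?_
  have h1 := ((hasDerivAt_line_normSq (hz.differentiableAt (by norm_num)) i).const_add 1).fun_pow 2
  have h := ((hasDerivAt_line_radD hz i).const_mul 2).fun_div h1 (by positivity)
  refine h.congr_deriv ?_
  have hr : ((starRingEnd ℂ) (z x) * cD i z x).re = radD i z x := rfl
  simp only [zero_smul, add_zero, hr]
  field_simp
  push_cast
  ring

/-- Product rule for `weight * ⟨z, ∇z⟩`: the derivative falls on `∇z`, on `z` or on the weight,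
which gives the three terms. -/
theorem div_fluxField {z : Plane → ℂ} {K : Set Plane} {x : Plane} (hx : K ∈ 𝓝 x)
    (hz : ContDiffAt ℝ 2 z x) :
    partialD 0 (fluxField K 0 z) x + partialD 1 (fluxField K 1 z) x
      = energyDensity z x + partsFirst z x + partsSecond z x := by
  have hd := hz.differentiableAt (by norm_num)
  rw [partialD_fluxField hx hz, partialD_fluxField hx hz, energyDensity_eq hd, partsFirst_eq hd,
    partsSecond_eq hz, cLap, mul_add ((starRingEnd ℂ) (z x)), Complex.add_re]
  ring

/-- The domain is not convex, but each of its points `x` lies in the half plane `|x| ≤ ⟨x / |x|,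
y⟩`, which is convex with nonempty interior and contained in the domain by Cauchy–Schwarz. -/
theorem uniqueDiffOn_northDomain : UniqueDiffOn ℝ northDomain := by
  intro x hx
  rw [northDomain_eq, mem_ofPred_eq] at hx
  have hconv : Convex ℝ {y : Plane | ‖x‖ ≤ inner ℝ (‖x‖⁻¹ • x) y} :=
    convex_halfSpace_ge (innerSL ℝ (‖x‖⁻¹ • x)).isLinear _
  have hx0 : ‖x‖ ≠ 0 := by linarith
  have hn : ‖‖x‖⁻¹ • x‖ = 1 := by
    rw [norm_smul, norm_inv, norm_norm, inv_mul_cancel₀ hx0]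
  have hxx : inner ℝ (‖x‖⁻¹ • x) x = ‖x‖ := by
    rw [inner_smul_left, real_inner_self_eq_norm_sq]
    simp only [map_inv₀, conj_trivial]
    field_simp
  have hint : (interior {y : Plane | ‖x‖ ≤ inner ℝ (‖x‖⁻¹ • x) y}).Nonempty := by
    refine ⟨(2 : ℝ) • x, mem_interior.2 ⟨{y : Plane | ‖x‖ < inner ℝ (‖x‖⁻¹ • x) y},
      fun y hy => le_of_lt (show ‖x‖ < _ from hy), isOpen_lt continuous_const (by fun_prop), ?_⟩⟩
    rw [mem_ofPred_eq, inner_smul_right, hxx]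
    linarith
  refine (uniqueDiffWithinAt_convex hconv hint (subset_closure ?_)).mono ?_
  · exact hxx.ge
  · intro y hy
    rw [northDomain_eq, mem_ofPred_eq]
    have h1 : ‖x‖ ≤ inner ℝ (‖x‖⁻¹ • x) y := hy
    have h2 := real_inner_le_norm (‖x‖⁻¹ • x) y
    rw [hn, one_mul] at h2
    linarith

theorem northDomain_mem_nhds {x : Plane} (hx : x ∈ northInterior) : northDomain ∈ 𝓝 x :=
  mem_of_superset (isOpen_northInterior.mem_nhds hx) northInterior_subset

/-! ### The reflection `1 / conj z` and the pointwise decomposition -/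

section Inversion

variable {z : Plane → ℂ} {x : Plane}

theorem inverted_eq (z : Plane → ℂ) : inverted z = fun x => ((starRingEnd ℂ) (z x))⁻¹ := by
  ext x; simp [inverted]

theorem ContDiffOn.inverted {K : Set Plane} {n : WithTop ℕ∞} (hz : ContDiffOn ℝ n z K)
    (h0 : ∀ x ∈ K, z x ≠ 0) : ContDiffOn ℝ n (inverted z) K := by
  rw [inverted_eq]
  exact (Complex.conjCLE.contDiff.comp_contDiffOn hz).inv fun x hx => by simpa using h0 x hx

theorem ContDiffAt.inverted {n : WithTop ℕ∞} (hz : ContDiffAt ℝ n z x)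
    (h0 : z x ≠ 0) : ContDiffAt ℝ n (inverted z) x := by
  rw [inverted_eq]
  exact (Complex.conjCLE.contDiff.contDiffAt.comp x hz).inv (by simpa using h0)

theorem norm_inverted (z : Plane → ℂ) (x : Plane) : ‖inverted z x‖ = ‖z x‖⁻¹ := by
  simp [inverted]

theorem hasDerivAt_line_conj (hz : DifferentiableAt ℝ z x) (i : Fin 2) :
    HasDerivAt (fun t : ℝ => (starRingEnd ℂ) (z (x + t • EuclideanSpace.single i (1 : ℝ))))
      ((starRingEnd ℂ) (cD i z x)) 0 :=
  (Complex.conjCLE.toContinuousLinearMap.hasFDerivAt).comp_hasDerivAt (0 : ℝ)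
    (hasDerivAt_line hz i)

theorem cD_inverted (hz : DifferentiableAt ℝ z x) (h0 : z x ≠ 0) (i : Fin 2) :
    cD i (inverted z) x = -(starRingEnd ℂ) (cD i z x) / (starRingEnd ℂ) (z x) ^ 2 := by
  have h0' : (starRingEnd ℂ) (z x) ≠ 0 := by simpa using h0
  have hd : DifferentiableAt ℝ (fun y => (starRingEnd ℂ) (z y)) x :=
    Complex.conjCLE.toContinuousLinearMap.differentiableAt.comp x hz
  rw [inverted_eq]
  refine fderiv_apply_eq (hd.fun_inv h0') ?_
  have h := (hasDerivAt_line_conj hz i).fun_inv (by simpa using h0)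
  simpa using h

theorem cD_cD_inverted (hz : ContDiffAt ℝ 2 z x) (h0 : z x ≠ 0) (i : Fin 2) :
    cD i (cD i (inverted z)) x = -(starRingEnd ℂ) (cD i (cD i z) x) / (starRingEnd ℂ) (z x) ^ 2
      + 2 * (starRingEnd ℂ) (cD i z x) ^ 2 / (starRingEnd ℂ) (z x) ^ 3 := by
  have h0' : (starRingEnd ℂ) (z x) ≠ 0 := by simpa using h0
  have hd := hz.differentiableAt (by norm_num)
  have hd' := (contDiffAt_cD hz i).differentiableAt (by norm_num)
  have he : cD i (inverted z) =ᶠ[𝓝 x]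
      fun y => -(starRingEnd ℂ) (cD i z y) / (starRingEnd ℂ) (z y) ^ 2 := by
    filter_upwards [hz.eventually (by simp), hd.continuousAt.eventually_ne h0] with y hy hy0
    exact cD_inverted (hy.differentiableAt (by norm_num)) hy0 i
  have hdi := (contDiffAt_cD (hz.inverted h0) i).differentiableAt (by norm_num)
  rw [cD, he.fderiv_eq]
  refine fderiv_apply_eq (hdi.congr_of_eventuallyEq he.symm) ?_
  have h := (hasDerivAt_line_conj hd' i).fun_neg.fun_div ((hasDerivAt_line_conj hd i).fun_pow 2)
    (by simpa using h0)
  refine h.congr_deriv ?_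
  simp only [zero_smul, add_zero]
  field_simp
  simp
  ring

/-- The reflection is an isometry of the sphere, so it preserves harmonic maps. In coordinates, the
equation for `1 / conj z` is a multiple of the complex conjugate of the equation for `z`. -/
theorem ComplexEL.inverted (hz : ContDiffAt ℝ 2 z x) (h0 : z x ≠ 0) (h : ComplexEL z x) :
    ComplexEL (inverted z) x := by
  have h0' : (starRingEnd ℂ) (z x) ≠ 0 := by simpa using h0
  have hd := hz.differentiableAt (by norm_num)
  have hN : (1 + z x * (starRingEnd ℂ) (z x) : ℂ) = (1 + ‖z x‖ ^ 2 : ℝ) := by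
    rw [Complex.mul_conj, ← Complex.sq_norm]; push_cast; ring
  have hN0 : (1 + z x * (starRingEnd ℂ) (z x) : ℂ) ≠ 0 := by
    rw [hN]; exact_mod_cast (one_add_sq_pos (z x)).ne'
  have hM : ((1 + ‖_root_.inverted z x‖ ^ 2 : ℝ) : ℂ)
      = (1 + z x * (starRingEnd ℂ) (z x)) / (z x * (starRingEnd ℂ) (z x)) := by
    have hn : ((‖z x‖ : ℂ)) ≠ 0 := by simpa using h0
    rw [norm_inverted, Complex.mul_conj, ← Complex.sq_norm]
    push_cast
    field_simp
    ring
  unfold ComplexEL at h ⊢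
  rw [hM, cD_inverted hd h0, cD_inverted hd h0, cLap, cD_cD_inverted hz h0, cD_cD_inverted hz h0]
  rw [← hN] at h
  have h' := congrArg (starRingEnd ℂ) h
  simp only [cLap, map_mul, map_add, map_one, Complex.conj_conj, map_pow, map_ofNat] at h'
  simp only [_root_.inverted, map_div₀, map_one, Complex.conj_conj]
  field_simp
  linear_combination (-(starRingEnd ℂ) (z x)) * h'

theorem normSq_cD_inverted (hz : DifferentiableAt ℝ z x) (h0 : z x ≠ 0) (i : Fin 2) :
    ‖cD i (inverted z) x‖ ^ 2 = ‖cD i z x‖ ^ 2 / ‖z x‖ ^ 4 := by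
  rw [cD_inverted hz h0]
  simp only [norm_div, norm_neg, norm_pow, RCLike.norm_conj]
  rw [div_pow]; ring

theorem energyDensity_inverted (hz : DifferentiableAt ℝ z x) (h0 : z x ≠ 0)
    (hi : DifferentiableAt ℝ (inverted z) x) :
    energyDensity (inverted z) x = energyDensity z x := by
  have hn : ‖z x‖ ≠ 0 := by simpa using h0
  have h1 : 1 + ‖z x‖ ^ 2 ≠ 0 := (one_add_sq_pos (z x)).ne'
  rw [energyDensity_eq hz, energyDensity_eq hi, normSq_cD_inverted hz h0, normSq_cD_inverted hz h0,
    norm_inverted, div_eq_div_iff (by positivity) (by positivity)]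
  field_simp
  ring

end Inversion

theorem logTerm_add_crossTerm {z : Plane → ℂ} {x : Plane} (hz : DifferentiableAt ℝ z x) :
    logTerm z x + crossTerm z x
      = 4 * ‖z x‖ ^ 2 * (‖cD 0 z x‖ ^ 2 + ‖cD 1 z x‖ ^ 2) / (1 + ‖z x‖ ^ 2) ^ 3 := by
  rw [logTerm_eq hz, crossTerm_eq hz, ← add_div]
  congr 1
  linear_combination 4 * radD_sq_add_angD_sq 0 z x + 4 * radD_sq_add_angD_sq 1 z x

/-- The first term contributes `8 radD²` and the second `-4 (radD² - angD²)`, summed over `i` and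
divided by `(1 + |z|²)³`. Together they are `4 (radD² + angD²)`, the full gradient. -/
theorem parts_eq_of_EL {z : Plane → ℂ} {x : Plane} (hz : ContDiffAt ℝ 2 z x)
    (h : ComplexEL z x) :
    -partsFirst z x - partsSecond z x
      = 4 * ‖z x‖ ^ 2 * (‖cD 0 z x‖ ^ 2 + ‖cD 1 z x‖ ^ 2) / (1 + ‖z x‖ ^ 2) ^ 3 := by
  rw [partsFirst_eq (hz.differentiableAt (by norm_num)), partsSecond_eq_of_EL hz h,
    mul_add ((starRingEnd ℂ) (z x) ^ 2),
    Complex.add_re, re_conj_sq_mul_sq, re_conj_sq_mul_sq, ← neg_div, ← sub_div]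
  congr 1
  linear_combination 4 * radD_sq_add_angD_sq 0 z x + 4 * radD_sq_add_angD_sq 1 z x

/-- The pointwise form of the decomposition of the northern energy. -/
theorem parts_eq_inverted {z : Plane → ℂ} {x : Plane} (hz : ContDiffAt ℝ 2 z x) (h0 : z x ≠ 0)
    (h : ComplexEL z x) :
    -partsFirst z x - partsSecond z x
      = -logTerm (inverted z) x + gradTerm (inverted z) x - crossTerm (inverted z) x := by
  have hd := hz.differentiableAt (by norm_num)
  have hd' := (hz.inverted h0).differentiableAt (by norm_num)
  have hn : ‖z x‖ ≠ 0 := by simpa using h0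
  have h1 : 1 + ‖z x‖ ^ 2 ≠ 0 := (one_add_sq_pos (z x)).ne'
  have e : -logTerm (inverted z) x + gradTerm (inverted z) x - crossTerm (inverted z) x
      = gradTerm (inverted z) x - (logTerm (inverted z) x + crossTerm (inverted z) x) := by ring
  rw [e, logTerm_add_crossTerm hd', parts_eq_of_EL hz h, gradTerm_eq,
    energyDensity_inverted hd h0 hd', energyDensity_eq hd, normSq_cD_inverted hd h0,
    normSq_cD_inverted hd h0, norm_inverted]
  have h2 : 1 + ‖z x‖⁻¹ ^ 2 = (1 + ‖z x‖ ^ 2) / ‖z x‖ ^ 2 := by field_simp; ring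
  rw [h2]
  field_simp
  ring

/-! ### First variation and the Euler–Lagrange equation -/

theorem continuousOn_cD {z : Plane → ℂ} {U : Set Plane} (hU : IsOpen U)
    (hz : ContDiffOn ℝ 1 z U) (i : Fin 2) : ContinuousOn (cD i z) U :=
  (hz.continuousOn_fderiv_of_isOpen hU (by norm_num)).clm_apply continuousOn_const

theorem contDiffOn_cD {z : Plane → ℂ} {U : Set Plane} (hU : IsOpen U)
    (hz : ContDiffOn ℝ 2 z U) (i : Fin 2) : ContDiffOn ℝ 1 (cD i z) U :=
  (hz.fderiv_of_isOpen hU (by norm_num)).clm_apply contDiffOn_const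

theorem continuousOn_cLap {z : Plane → ℂ} {U : Set Plane} (hU : IsOpen U)
    (hz : ContDiffOn ℝ 2 z U) : ContinuousOn (cLap z) U :=
  (continuousOn_cD hU (contDiffOn_cD hU hz 0) 0).add (continuousOn_cD hU (contDiffOn_cD hU hz 1) 1)

/-- The energy density of `z + t φ`. -/
noncomputable def variedDensity (z φ : Plane → ℂ) (t : ℝ) (x : Plane) : ℝ :=
  2 * (‖cD 0 z x + t • cD 0 φ x‖ ^ 2 + ‖cD 1 z x + t • cD 1 φ x‖ ^ 2)
    / (1 + ‖z x + t • φ x‖ ^ 2) ^ 2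

/-- The derivative of `variedDensity` in `t`. -/
noncomputable def variedDensityDeriv (z φ : Plane → ℂ) (t : ℝ) (x : Plane) : ℝ :=
  4 * (inner ℝ (cD 0 z x + t • cD 0 φ x) (cD 0 φ x)
      + inner ℝ (cD 1 z x + t • cD 1 φ x) (cD 1 φ x)) / (1 + ‖z x + t • φ x‖ ^ 2) ^ 2
    - 8 * (‖cD 0 z x + t • cD 0 φ x‖ ^ 2 + ‖cD 1 z x + t • cD 1 φ x‖ ^ 2)
      * inner ℝ (z x + t • φ x) (φ x) / (1 + ‖z x + t • φ x‖ ^ 2) ^ 3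

theorem energyDensity_add_smul {z φ : Plane → ℂ} {x : Plane} (hz : DifferentiableAt ℝ z x)
    (hφ : DifferentiableAt ℝ φ x) (t : ℝ) :
    energyDensity (fun y => z y + t • φ y) x = variedDensity z φ t x := by
  have h : ∀ i, cD i (fun y => z y + t • φ y) x = cD i z x + t • cD i φ x := fun i => by
    rw [cD, (hz.hasFDerivAt.fun_add (hφ.hasFDerivAt.fun_const_smul t)).fderiv]
    rfl
  rw [energyDensity_eq (hz.fun_add (hφ.fun_const_smul t)), h, h, variedDensity]

theorem hasDerivAt_variedDensity (z φ : Plane → ℂ) (t : ℝ) (x : Plane) :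
    HasDerivAt (fun t => variedDensity z φ t x) (variedDensityDeriv z φ t x) t := by
  have hl : ∀ a b : ℂ, HasDerivAt (fun t : ℝ => a + t • b) b t := fun a b => by
    simpa using ((hasDerivAt_id t).smul_const b).const_add a
  have hN := one_add_sq_pos (z x + t • φ x)
  have h1 := (((hl (cD 0 z x) (cD 0 φ x)).norm_sq.fun_add
    (hl (cD 1 z x) (cD 1 φ x)).norm_sq).const_mul 2).fun_div
    (((hl (z x) (φ x)).norm_sq.const_add 1).fun_pow 2) (by positivity)
  refine h1.congr_deriv ?_
  rw [variedDensityDeriv]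
  field_simp
  push_cast
  ring

theorem continuousOn_variedDensity {z φ : Plane → ℂ} {U : Set Plane} (hU : IsOpen U)
    (hz : ContDiffOn ℝ 1 z U) (hφ : ContDiff ℝ 1 φ) (t : ℝ) :
    ContinuousOn (variedDensity z φ t) U := by
  have h0 := hz.continuousOn
  have h1 := continuousOn_cD hU hz
  have h2 := hφ.continuous.continuousOn (s := U)
  have h3 := continuousOn_cD hU hφ.contDiffOn
  have hd : ∀ x ∈ U, (1 + ‖z x + t • φ x‖ ^ 2) ^ 2 ≠ 0 := fun x _ =>
    (pow_pos (one_add_sq_pos _) 2).ne'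
  exact (continuousOn_const.mul ((((h1 0).add ((h3 0).const_smul t)).norm.pow 2).add
    (((h1 1).add ((h3 1).const_smul t)).norm.pow 2))).div
    ((continuousOn_const.add ((h0.add (h2.const_smul t)).norm.pow 2)).pow 2) hd

theorem continuousOn_variedDensityDeriv {z φ : Plane → ℂ} {U : Set Plane} (hU : IsOpen U)
    (hz : ContDiffOn ℝ 1 z U) (hφ : ContDiff ℝ 1 φ) :
    ContinuousOn (fun p : ℝ × Plane => variedDensityDeriv z φ p.1 p.2) (univ ×ˢ U) := by
  have hm : MapsTo Prod.snd (univ ×ˢ U : Set (ℝ × Plane)) U := fun p hp => hp.2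
  have hs : ContinuousOn Prod.snd (univ ×ˢ U : Set (ℝ × Plane)) := continuousOn_snd
  have hf : ContinuousOn Prod.fst (univ ×ˢ U : Set (ℝ × Plane)) := continuousOn_fst
  have h2 := hφ.continuous.continuousOn.comp hs hm
  have h3 := fun i => (continuousOn_cD hU hφ.contDiffOn i).comp hs hm
  have h0 := (hz.continuousOn.comp hs hm).add (hf.smul h2)
  have h1 := fun i => ((continuousOn_cD hU hz i).comp hs hm).add (hf.smul (h3 i))
  have hN := continuousOn_const (c := (1 : ℝ)).add (h0.norm.pow 2)
  refine ((continuousOn_const.mul (((h1 0).inner (𝕜 := ℝ) (h3 0)).add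
    ((h1 1).inner (𝕜 := ℝ) (h3 1)))).div (hN.pow 2) fun p _ => ?_).sub
    (((continuousOn_const.mul (((h1 0).norm.pow 2).add ((h1 1).norm.pow 2))).mul
      (h0.inner (𝕜 := ℝ) h2)).div (hN.pow 3) fun p _ => ?_)
  · exact (pow_pos (one_add_sq_pos _) 2).ne'
  · exact (pow_pos (one_add_sq_pos _) 3).ne'

theorem cD_eq_zero_of_notMem_tsupport {φ : Plane → ℂ} {x : Plane} (hx : x ∉ tsupport φ)
    (i : Fin 2) : cD i φ x = 0 := by
  have : x ∉ Function.support (fderiv ℝ φ) := fun h => hx (support_fderiv_subset ℝ h)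
  rw [cD, Function.notMem_support.1 this]
  rfl

theorem integral_northDomain (f : Plane → ℝ) :
    ∫ x in northDomain, f x = ∫ x in northInterior, f x :=
  setIntegral_congr_set northDomain_ae_eq

theorem integrableOn_northDomain_iff {f : Plane → ℝ} :
    IntegrableOn f northDomain ↔ IntegrableOn f northInterior :=
  integrableOn_congr_set_ae northDomain_ae_eq

/-- The first variation of the northern energy. -/
theorem hasDerivAt_energyN {z φ : Plane → ℂ} (hz : ContDiffOn ℝ 1 z northInterior)
    (hfin : IntegrableOn (energyDensity z) northDomain) (hφ : ContDiff ℝ 1 φ)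
    (hc : HasCompactSupport φ) (hs : tsupport φ ⊆ northInterior) :
    HasDerivAt (fun t : ℝ => energyN (fun x => z x + t • φ x))
      (∫ x in northInterior, variedDensityDeriv z φ 0 x) 0 := by
  have hU := isOpen_northInterior
  have hzd : ∀ x ∈ northInterior, DifferentiableAt ℝ z x := fun x hx =>
    (hz.contDiffAt (hU.mem_nhds hx)).differentiableAt (by norm_num)
  have hcont := continuousOn_variedDensityDeriv hU hz hφ
  have hK : IsCompact (Icc (-1 : ℝ) 1 ×ˢ tsupport φ) := isCompact_Icc.prod hc
  obtain ⟨C, hC⟩ := hK.exists_bound_of_continuousOn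
    (hcont.mono (prod_mono (subset_univ _) hs))
  -- Off the support of `φ` the density does not depend on `t`; on it, `C` comes from compactness of
  -- `[-1, 1] × tsupport φ`. So a constant on a compact set dominates.
  have hbound : ∀ x, ∀ t ∈ Ioo (-1 : ℝ) 1,
      ‖variedDensityDeriv z φ t x‖ ≤ (tsupport φ).indicator (fun _ => C) x := by
    intro x t ht
    by_cases hx : x ∈ tsupport φ
    · rw [indicator_of_mem hx]
      exact hC (t, x) ⟨Ioo_subset_Icc_self ht, hx⟩
    · rw [indicator_of_notMem hx, variedDensityDeriv, cD_eq_zero_of_notMem_tsupport hx,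
        cD_eq_zero_of_notMem_tsupport hx, image_eq_zero_of_notMem_tsupport hx]
      simp
  have hFeq : ∀ t, energyN (fun x => z x + t • φ x)
      = ∫ x in northInterior, variedDensity z φ t x := by
    intro t
    rw [energyN, dirichletEnergy, integral_northDomain]
    exact setIntegral_congr_fun hU.measurableSet fun x hx =>
      energyDensity_add_smul (hzd x hx) (hφ.differentiable (by norm_num) x) t
  simp only [hFeq]
  refine (hasDerivAt_integral_of_dominated_loc_of_deriv_le (F' := variedDensityDeriv z φ)
    (Ioo_mem_nhds (by norm_num : (-1 : ℝ) < 0) (by norm_num : (0 : ℝ) < 1))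
    (Eventually.of_forall fun t =>
      (continuousOn_variedDensity hU hz hφ t).aestronglyMeasurable hU.measurableSet) ?_ ?_
    (Eventually.of_forall hbound) ?_
    (Eventually.of_forall fun x t _ => hasDerivAt_variedDensity z φ t x)).2
  · refine (integrableOn_northDomain_iff.1 hfin).congr_fun (fun x hx => ?_) hU.measurableSet
    simpa using energyDensity_add_smul (hzd x hx) (hφ.differentiable (by norm_num) x) 0
  · refine ContinuousOn.aestronglyMeasurable ?_ hU.measurableSet
    exact hcont.comp (f := fun x => ((0 : ℝ), x)) (by fun_prop) fun x hx => ⟨mem_univ _, hx⟩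
  · exact ((integrable_indicator_iff (isClosed_tsupport φ).measurableSet).2
      (integrableOn_const hc.measure_lt_top.ne)).restrict

/-- The coefficient of a test function in direction `c` in the first variation, after integration
by parts. -/
noncomputable def variationCoeff (z : Plane → ℂ) (c : ℂ) (x : Plane) : ℝ :=
  -4 * inner ℝ (cLap z x) c / (1 + ‖z x‖ ^ 2) ^ 2
    + 16 * (inner ℝ (cD 0 z x) c * radD 0 z x + inner ℝ (cD 1 z x) c * radD 1 z x)
      / (1 + ‖z x‖ ^ 2) ^ 3
    - 8 * (‖cD 0 z x‖ ^ 2 + ‖cD 1 z x‖ ^ 2) * inner ℝ (z x) c / (1 + ‖z x‖ ^ 2) ^ 3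

theorem continuousOn_radD {z : Plane → ℂ} {U : Set Plane} (hU : IsOpen U)
    (hz : ContDiffOn ℝ 1 z U) (i : Fin 2) : ContinuousOn (radD i z) U :=
  Complex.continuous_re.comp_continuousOn
    ((Complex.continuous_conj.comp_continuousOn hz.continuousOn).mul (continuousOn_cD hU hz i))

theorem continuousOn_variationCoeff {z : Plane → ℂ} {U : Set Plane} (hU : IsOpen U)
    (hz : ContDiffOn ℝ 2 z U) (c : ℂ) : ContinuousOn (variationCoeff z c) U := by
  have h1 : ContDiffOn ℝ 1 z U := hz.of_le (by norm_num)
  have hD := continuousOn_cD hU h1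
  have hR := continuousOn_radD hU h1
  have hL := continuousOn_cLap hU hz
  have hN := continuousOn_one_add_normSq hz.continuousOn
  have hc : ContinuousOn (fun _ : Plane => c) U := continuousOn_const
  refine (((continuousOn_const.mul (hL.inner (𝕜 := ℝ) hc)).div (hN.pow 2) fun x _ => ?_).add
    ((continuousOn_const.mul ((((hD 0).inner (𝕜 := ℝ) hc).mul (hR 0)).add
      (((hD 1).inner (𝕜 := ℝ) hc).mul (hR 1)))).div (hN.pow 3) fun x _ => ?_)).sub
    (((continuousOn_const.mul (((hD 0).norm.pow 2).add ((hD 1).norm.pow 2))).mul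
      (hz.continuousOn.inner (𝕜 := ℝ) hc)).div (hN.pow 3) fun x _ => ?_)
  · exact (pow_pos (one_add_sq_pos _) 2).ne'
  · exact (pow_pos (one_add_sq_pos _) 3).ne'
  · exact (pow_pos (one_add_sq_pos _) 3).ne'

/-- The directions `1` and `i` give the equation `(1 + |z|²) Δz = 4 ∑ radDᵢ ∂ᵢ z - 2 |∇z|² z`. It
agrees with `ComplexEL` because `2 Re(conj z a) a - |a|² z = conj z a²` for complex `a`. -/
theorem complexEL_of_variationCoeff_eq_zero {z : Plane → ℂ} {x : Plane}
    (h : ∀ c, variationCoeff z c x = 0) : ComplexEL z x := by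
  have hN := one_add_sq_pos (z x)
  have key : ∀ c : ℂ, (1 + ‖z x‖ ^ 2) * inner ℝ (cLap z x) c
      = 4 * (inner ℝ (cD 0 z x) c * radD 0 z x + inner ℝ (cD 1 z x) c * radD 1 z x)
        - 2 * (‖cD 0 z x‖ ^ 2 + ‖cD 1 z x‖ ^ 2) * inner ℝ (z x) c := by
    intro c
    have := h c
    rw [variationCoeff] at this
    field_simp at this
    linear_combination (-1 / 4 : ℝ) * this
  have h1 := key 1
  have h2 := key Complex.I
  simp only [Complex.inner, radD_eq, Complex.sq_norm, Complex.normSq_apply] at h1 h2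
  unfold ComplexEL
  rw [Complex.sq_norm, Complex.normSq_apply]
  apply Complex.ext
  · simp [pow_two] at h1 ⊢
    linear_combination h1
  · simp [pow_two] at h2 ⊢
    linear_combination h2

/-- The integral of a partial derivative of a compactly supported function vanishes. -/
theorem integral_partialD_eq_zero {f : Plane → ℝ} (hf : ContDiff ℝ 1 f) (hc : HasCompactSupport f)
    (i : Fin 2) : ∫ x, partialD i f x = 0 := by
  have hi : Integrable (fun x => partialD i f x) :=
    ((hf.continuous_fderiv (by norm_num)).clm_apply continuous_const).integrable_of_hasCompactSupport
      (hc.fderiv_apply ℝ _)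
  have h := integral_mul_fderiv_eq_neg_fderiv_mul_of_integrable (μ := (volume : Measure Plane))
    (f := fun _ : Plane => (1 : ℝ)) (g := f) (v := EuclideanSpace.single i 1)
    (by simp) (by simpa [partialD] using hi)
    (by simpa using hf.continuous.integrable_of_hasCompactSupport hc)
    (fun x _ => differentiableAt_const _) (fun x _ => hf.differentiable (by norm_num) x)
  simpa [partialD] using h

/-- The coefficient of `∂ᵢ g` in the first variation in direction `g c`. -/
noncomputable def momentum (z : Plane → ℂ) (c : ℂ) (i : Fin 2) (x : Plane) : ℝ :=
  4 * inner ℝ (cD i z x) c / (1 + ‖z x‖ ^ 2) ^ 2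

theorem contDiffAt_momentum {z : Plane → ℂ} {x : Plane} (hz : ContDiffAt ℝ 2 z x) (c : ℂ)
    (i : Fin 2) : ContDiffAt ℝ 1 (momentum z c i) x := by
  have h1 : ContDiffAt ℝ 1 (fun y => (1 + ‖z y‖ ^ 2) ^ 2) x :=
    (contDiffAt_const.add ((hz.of_le (by norm_num)).norm_sq ℝ)).pow 2
  exact (contDiffAt_const.mul ((contDiffAt_cD hz i).inner ℝ contDiffAt_const)).div h1
    (pow_pos (one_add_sq_pos _) 2).ne'

theorem partialD_momentum {z : Plane → ℂ} {x : Plane} (hz : ContDiffAt ℝ 2 z x) (c : ℂ)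
    (i : Fin 2) :
    partialD i (momentum z c i) x = 4 * inner ℝ (cD i (cD i z) x) c / (1 + ‖z x‖ ^ 2) ^ 2
      - 16 * inner ℝ (cD i z x) c * radD i z x / (1 + ‖z x‖ ^ 2) ^ 3 := by
  have hN := one_add_sq_pos (z x)
  have hd := hz.differentiableAt (by norm_num)
  have hd' := (contDiffAt_cD hz i).differentiableAt (by norm_num)
  refine fderiv_apply_eq ((contDiffAt_momentum hz c i).differentiableAt (by norm_num)) ?_
  have h1 := ((hasDerivAt_line_normSq hd i).const_add 1).fun_pow 2
  have h2 := (hasDerivAt_line hd' i).inner ℝ (hasDerivAt_const (0 : ℝ) c)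
  have h := (h2.const_mul 4).fun_div h1 (by positivity)
  refine h.congr_deriv ?_
  have hr : ((starRingEnd ℂ) (z x) * cD i z x).re = radD i z x := rfl
  simp only [zero_smul, add_zero, hr, inner_zero_right, zero_add]
  field_simp
  push_cast
  ring

theorem variationCoeff_eq {z : Plane → ℂ} {x : Plane} (hz : ContDiffAt ℝ 2 z x) (c : ℂ) :
    variationCoeff z c x = -partialD 0 (momentum z c 0) x - partialD 1 (momentum z c 1) x
      - 8 * (‖cD 0 z x‖ ^ 2 + ‖cD 1 z x‖ ^ 2) * inner ℝ (z x) c / (1 + ‖z x‖ ^ 2) ^ 3 := by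
  rw [partialD_momentum hz, partialD_momentum hz, variationCoeff, cLap, inner_add_left]
  ring

theorem partialD_mul {f g : Plane → ℝ} {x : Plane} (hf : DifferentiableAt ℝ f x)
    (hg : DifferentiableAt ℝ g x) (i : Fin 2) :
    partialD i (fun y => f y * g y) x = partialD i f x * g x + f x * partialD i g x := by
  rw [partialD, (hf.hasFDerivAt.fun_mul hg.hasFDerivAt).fderiv]
  simp [partialD]
  ring

/-- Integration by parts in pointwise form: the terms with `∂ᵢ g` are absorbed into the divergence
of `g` times `momentum`, which integrates to zero for compactly supported `g`. -/
theorem variedDensityDeriv_smul {z : Plane → ℂ} {g : Plane → ℝ} {x : Plane}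
    (hz : ContDiffAt ℝ 2 z x) (hg : DifferentiableAt ℝ g x) (c : ℂ) :
    variedDensityDeriv z (fun y => g y • c) 0 x
      = g x * variationCoeff z c x + (partialD 0 (fun y => g y * momentum z c 0 y) x
        + partialD 1 (fun y => g y * momentum z c 1 y) x) := by
  have h : ∀ i, cD i (fun y => g y • c) x = partialD i g x • c := fun i => by
    rw [cD, (hg.hasFDerivAt.smul_const c).fderiv]; rfl
  have hm := fun i => (contDiffAt_momentum hz c i).differentiableAt (by norm_num)
  rw [partialD_mul hg (hm 0), partialD_mul hg (hm 1), variationCoeff_eq hz, variedDensityDeriv,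
    h, h]
  simp only [zero_smul, add_zero, inner_smul_right, momentum]
  ring

theorem integral_mul_variationCoeff {z : Plane → ℂ} (hz : ContDiffOn ℝ 2 z northInterior)
    (hfin : IntegrableOn (energyDensity z) northDomain) (hcrit : IsCriticalN z) (c : ℂ)
    {g : Plane → ℝ} (hg : ContDiff ℝ (⊤ : ℕ∞) g) (hgc : HasCompactSupport g)
    (hgs : tsupport g ⊆ northInterior) : ∫ x, g x • variationCoeff z c x = 0 := by
  have hU := isOpen_northInterior
  have hz2 : ∀ x ∈ northInterior, ContDiffAt ℝ 2 z x := fun x hx => hz.contDiffAt (hU.mem_nhds hx)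
  have hg1 : ContDiff ℝ 1 g := hg.of_le (by exact_mod_cast le_top)
  set φ : Plane → ℂ := fun y => g y • c with hφ
  have hφs : tsupport φ ⊆ tsupport g :=
    closure_mono fun x hx => fun h0 => hx (by simp [hφ, h0])
  have hφc : HasCompactSupport φ := hgc.of_isClosed_subset (isClosed_tsupport φ) hφs
  have h1 : ∫ x in northInterior, variedDensityDeriv z φ 0 x = 0 :=
    (hasDerivAt_energyN (hz.of_le (by norm_num)) hfin (hg1.smul contDiff_const) hφc
    (hφs.trans hgs)).unique (hcrit φ (hg.smul contDiff_const) hφc (hφs.trans hgs))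
  rw [setIntegral_congr_fun hU.measurableSet fun x hx =>
    variedDensityDeriv_smul (hz2 x hx) (hg1.differentiable (by norm_num) x) c] at h1
  -- `momentum` is controlled only in the open exterior, but off the support of `g` the product
  -- vanishes locally, so it is `C¹` on the whole plane.
  have hm : ∀ i, ContDiff ℝ 1 fun y => g y * momentum z c i y := fun i => by
    refine contDiff_iff_contDiffAt.2 fun x => ?_
    by_cases hx : x ∈ tsupport g
    · exact hg1.contDiffAt.mul (contDiffAt_momentum (hz2 x (hgs hx)) c i)
    · have he : (fun y => g y * momentum z c i y) =ᶠ[𝓝 x] fun _ => 0 := by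
        filter_upwards [(isClosed_tsupport g).isOpen_compl.mem_nhds hx] with y hy
        rw [image_eq_zero_of_notMem_tsupport hy, zero_mul]
      exact contDiffAt_const.congr_of_eventuallyEq he
  have hmc : ∀ i, HasCompactSupport fun y => g y * momentum z c i y := fun i => hgc.mul_right
  have hpi : ∀ i, Integrable fun x => partialD i (fun y => g y * momentum z c i y) x := fun i =>
    (((hm i).continuous_fderiv (by norm_num)).clm_apply
      continuous_const).integrable_of_hasCompactSupport ((hmc i).fderiv_apply ℝ _)
  have hp0 : ∀ i, ∫ x in northInterior, partialD i (fun y => g y * momentum z c i y) x = 0 := by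
    intro i
    rw [setIntegral_eq_integral_of_forall_compl_eq_zero, integral_partialD_eq_zero (hm i) (hmc i)]
    intro x hx
    have : x ∉ Function.support (fderiv ℝ fun y => g y * momentum z c i y) := fun h =>
      hx (hgs (tsupport_mul_subset_left (support_fderiv_subset ℝ h)))
    rw [partialD, Function.notMem_support.1 this]
    rfl
  have hgv : Continuous fun x => g x * variationCoeff z c x := by
    refine continuous_iff_continuousAt.2 fun x => ?_
    by_cases hx : x ∈ tsupport g
    · exact hg1.continuous.continuousAt.mul
        ((continuousOn_variationCoeff hU hz c).continuousAt (hU.mem_nhds (hgs hx)))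
    · have he : (fun x => g x * variationCoeff z c x) =ᶠ[𝓝 x] fun _ => 0 := by
        filter_upwards [(isClosed_tsupport g).isOpen_compl.mem_nhds hx] with y hy
        rw [image_eq_zero_of_notMem_tsupport hy, zero_mul]
      exact continuousAt_const.congr he.symm
  have hgi : Integrable fun x => g x * variationCoeff z c x :=
    hgv.integrable_of_hasCompactSupport hgc.mul_right
  have hps : IntegrableOn (fun x => partialD 0 (fun y => g y * momentum z c 0 y) x
      + partialD 1 (fun y => g y * momentum z c 1 y) x) northInterior :=
    ((hpi 0).add (hpi 1)).integrableOn
  rw [integral_add hgi.integrableOn hps,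
    integral_add (hpi 0).integrableOn (hpi 1).integrableOn, hp0, hp0, add_zero, add_zero,
    setIntegral_eq_integral_of_forall_compl_eq_zero] at h1
  · simpa using h1
  · intro x hx
    rw [image_eq_zero_of_notMem_tsupport fun h => hx (hgs h), zero_mul]

/-- A critical point of the northern energy satisfies the Euler–Lagrange equation. -/
theorem complexEL_of_isCriticalN {z : Plane → ℂ} (hz : ContDiffOn ℝ 2 z northInterior)
    (hfin : IntegrableOn (energyDensity z) northDomain) (hcrit : IsCriticalN z) {x : Plane}
    (hx : x ∈ northInterior) : ComplexEL z x := by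
  have hU := isOpen_northInterior
  refine complexEL_of_variationCoeff_eq_zero fun c => ?_
  have hcont := continuousOn_variationCoeff hU hz c
  have hae := hU.ae_eq_zero_of_integral_contDiff_smul_eq_zero (μ := volume)
    (hcont.locallyIntegrableOn hU.measurableSet)
    fun g hg hgc hgs => integral_mul_variationCoeff hz hfin hcrit c hg hgc hgs
  exact Measure.eqOn_open_of_ae_eq (μ := volume) ((ae_restrict_iff' hU.measurableSet).2 hae) hU
    hcont continuousOn_const hx

/-! ### Convergence of the integrals and integration by parts in the north -/

theorem IntegrableOn.of_continuousOn_of_abs_le {f e : Plane → ℝ} {U : Set Plane} (hU : IsOpen U)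
    (hf : ContinuousOn f U) (he : IntegrableOn e U) (C : ℝ) (h : ∀ x ∈ U, |f x| ≤ C * e x) :
    IntegrableOn f U :=
  (he.const_mul C).mono' (hf.aestronglyMeasurable hU.measurableSet)
    ((ae_restrict_mem hU.measurableSet).mono h)

theorem radD_sq_add_le (z : Plane → ℂ) (x : Plane) :
    radD 0 z x ^ 2 + radD 1 z x ^ 2 ≤ ‖z x‖ ^ 2 * (‖cD 0 z x‖ ^ 2 + ‖cD 1 z x‖ ^ 2) := by
  nlinarith [radD_sq_add_angD_sq 0 z x, radD_sq_add_angD_sq 1 z x, sq_nonneg (angD 0 z x),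
    sq_nonneg (angD 1 z x)]

theorem angD_sq_add_le (z : Plane → ℂ) (x : Plane) :
    angD 0 z x ^ 2 + angD 1 z x ^ 2 ≤ ‖z x‖ ^ 2 * (‖cD 0 z x‖ ^ 2 + ‖cD 1 z x‖ ^ 2) := by
  nlinarith [radD_sq_add_angD_sq 0 z x, radD_sq_add_angD_sq 1 z x, sq_nonneg (radD 0 z x),
    sq_nonneg (radD 1 z x)]

/-- A quantity bounded by `|z|² |∇z|²` is dominated by the energy density. -/
theorem div_le_energyDensity {z : Plane → ℂ} {x : Plane} (hz : DifferentiableAt ℝ z x) {S : ℝ}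
    (hS : S ≤ ‖z x‖ ^ 2 * (‖cD 0 z x‖ ^ 2 + ‖cD 1 z x‖ ^ 2)) {n : ℕ} (hn : 3 ≤ n) :
    S / (1 + ‖z x‖ ^ 2) ^ n ≤ energyDensity z x / 2 := by
  rw [energyDensity_eq hz]
  set G := ‖cD 0 z x‖ ^ 2 + ‖cD 1 z x‖ ^ 2 with hG
  have hN : 1 ≤ 1 + ‖z x‖ ^ 2 := by nlinarith [sq_nonneg ‖z x‖]
  set N := 1 + ‖z x‖ ^ 2 with hNdef
  have hN0 : 0 < N := by linarith
  have hG0 : 0 ≤ G := by positivity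
  have h1 : S * N ^ 2 ≤ G * N ^ n := by
    have h2 : S ≤ N * G := hS.trans (by nlinarith)
    calc S * N ^ 2 ≤ N * G * N ^ 2 := by gcongr
      _ = G * N ^ 3 := by ring
      _ ≤ G * N ^ n := by gcongr
  rw [div_le_iff₀ (by positivity)]
  have e : 2 * G / N ^ 2 / 2 * N ^ n = G * N ^ n / N ^ 2 := by field_simp
  rw [e, le_div_iff₀ (by positivity)]
  exact h1

section Open

variable {z : Plane → ℂ} {U : Set Plane}

theorem continuousOn_angD (hU : IsOpen U)
    (hz : ContDiffOn ℝ 1 z U) (i : Fin 2) : ContinuousOn (angD i z) U :=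
  Complex.continuous_im.comp_continuousOn
    ((Complex.continuous_conj.comp_continuousOn hz.continuousOn).mul (continuousOn_cD hU hz i))

theorem integrableOn_radD (hU : IsOpen U) (hz : ContDiffOn ℝ 1 z U)
    (he : IntegrableOn (energyDensity z) U) {n : ℕ} (hn : 3 ≤ n) :
    IntegrableOn (fun x => (radD 0 z x ^ 2 + radD 1 z x ^ 2) / (1 + ‖z x‖ ^ 2) ^ n) U := by
  have hR := continuousOn_radD hU hz
  refine IntegrableOn.of_continuousOn_of_abs_le hU ((((hR 0).pow 2).add ((hR 1).pow 2)).div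
    ((continuousOn_one_add_normSq hz.continuousOn).pow n)
    fun x _ => (pow_pos (one_add_sq_pos _) n).ne') he (1 / 2) fun x hx => ?_
  have hd := (hz.contDiffAt (hU.mem_nhds hx)).differentiableAt (by norm_num)
  rw [abs_of_nonneg (by positivity)]
  exact (div_le_energyDensity hd (radD_sq_add_le z x) hn).trans (by linarith)

theorem integrableOn_angD (hU : IsOpen U) (hz : ContDiffOn ℝ 1 z U)
    (he : IntegrableOn (energyDensity z) U) :
    IntegrableOn (fun x => (angD 0 z x ^ 2 + angD 1 z x ^ 2) / (1 + ‖z x‖ ^ 2) ^ 3) U := by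
  have hR := continuousOn_angD hU hz
  refine IntegrableOn.of_continuousOn_of_abs_le hU ((((hR 0).pow 2).add ((hR 1).pow 2)).div
    ((continuousOn_one_add_normSq hz.continuousOn).pow 3)
    fun x _ => (pow_pos (one_add_sq_pos _) 3).ne') he (1 / 2) fun x hx => ?_
  have hd := (hz.contDiffAt (hU.mem_nhds hx)).differentiableAt (by norm_num)
  rw [abs_of_nonneg (by positivity)]
  exact (div_le_energyDensity hd (angD_sq_add_le z x) le_rfl).trans (by linarith)

theorem integrableOn_logTerm (hU : IsOpen U) (hz : ContDiffOn ℝ 1 z U)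
    (he : IntegrableOn (energyDensity z) U) : IntegrableOn (logTerm z) U := by
  refine IntegrableOn.congr_fun ((integrableOn_radD hU hz he le_rfl).const_mul 4) (fun x hx => ?_)
    hU.measurableSet
  rw [logTerm_eq ((hz.contDiffAt (hU.mem_nhds hx)).differentiableAt (by norm_num)), mul_div_assoc]

theorem integrableOn_crossTerm (hU : IsOpen U) (hz : ContDiffOn ℝ 1 z U)
    (he : IntegrableOn (energyDensity z) U) : IntegrableOn (crossTerm z) U := by
  refine IntegrableOn.congr_fun ((integrableOn_angD hU hz he).const_mul 4) (fun x hx => ?_)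
    hU.measurableSet
  rw [crossTerm_eq ((hz.contDiffAt (hU.mem_nhds hx)).differentiableAt (by norm_num)),
    mul_div_assoc]

theorem integrableOn_partsFirst (hU : IsOpen U) (hz : ContDiffOn ℝ 1 z U)
    (he : IntegrableOn (energyDensity z) U) : IntegrableOn (partsFirst z) U := by
  refine IntegrableOn.congr_fun ((integrableOn_radD hU hz he le_rfl).const_mul (-8)) (fun x hx => ?_)
    hU.measurableSet
  rw [partsFirst_eq ((hz.contDiffAt (hU.mem_nhds hx)).differentiableAt (by norm_num)),
    mul_div_assoc]

/-- Finite energy alone does not control `Δz`; the equation turns the integrand into a difference of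
`radD` and `angD` terms, each dominated by the energy density. -/
theorem integrableOn_partsSecond (hU : IsOpen U) (hz : ContDiffOn ℝ 2 z U)
    (he : IntegrableOn (energyDensity z) U) (hEL : ∀ x ∈ U, ComplexEL z x) :
    IntegrableOn (partsSecond z) U := by
  have h1 : ContDiffOn ℝ 1 z U := hz.of_le (by norm_num)
  refine IntegrableOn.congr_fun (((integrableOn_radD hU h1 he le_rfl).sub (integrableOn_angD hU h1 he)).const_mul
    4) (fun x hx => ?_) hU.measurableSet
  simp only [Pi.sub_apply]
  rw [partsSecond_eq_of_EL (hz.contDiffAt (hU.mem_nhds hx)) (hEL x hx), mul_add, Complex.add_re,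
    re_conj_sq_mul_sq, re_conj_sq_mul_sq]
  ring

end Open

/-- Integration by parts for the northern energy. -/
theorem energyN_eq_energyByParts {z : Plane → ℂ} (hz : ContDiffOn ℝ 2 z northDomain)
    (hfin : IntegrableOn (energyDensity z) northDomain)
    (hEL : ∀ x ∈ northInterior, ComplexEL z x) :
    energyN z = energyByParts northDomain z - circleTerm northDomain z := by
  have hU := isOpen_northInterior
  have hzU := hz.mono northInterior_subset
  have hz1 : ContDiffOn ℝ 1 z northInterior := hzU.of_le (by norm_num)
  have hz2 : ∀ x ∈ northInterior, ContDiffAt ℝ 2 z x := fun x hx => hzU.contDiffAt (hU.mem_nhds hx)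
  have he := integrableOn_northDomain_iff.1 hfin
  have hF := integrableOn_partsFirst hU hz1 he
  have hS := integrableOn_partsSecond hU hzU he hEL
  have hdiv : ∀ x ∈ northInterior, partialD 0 (fluxField northDomain 0 z) x
      + partialD 1 (fluxField northDomain 1 z) x
      = energyDensity z x + partsFirst z x + partsSecond z x := fun x hx =>
    div_fluxField (northDomain_mem_nhds hx) (hz2 x hx)
  have hint : IntegrableOn (fun x => energyDensity z x + partsFirst z x + partsSecond z x)
      northInterior := (he.add hF).add hS
  have heF : IntegrableOn (fun x => energyDensity z x + partsFirst z x) northInterior := he.add hF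
  have h := integral_div_northInterior
    (continuousOn_fluxField uniqueDiffOn_northDomain hz 0)
    (continuousOn_fluxField uniqueDiffOn_northDomain hz 1)
    (fun x hx => differentiableAt_fluxField (northDomain_mem_nhds hx) (hz2 x hx) 0)
    (fun x hx => differentiableAt_fluxField (northDomain_mem_nhds hx) (hz2 x hx) 1)
    (hint.congr_fun (fun x hx => (hdiv x hx).symm) hU.measurableSet) ?_
  · rw [setIntegral_congr_fun hU.measurableSet hdiv, integral_add heF hS, integral_add he hF,
      ← circleTerm_eq_flux] at h
    rw [energyN, dirichletEnergy, energyByParts, integral_northDomain, integral_northDomain,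
      integral_northDomain]
    linarith
  -- Square integrability of the field: the sum of the squares of its coordinates is `4 (radD₀² +
  -- radD₁²) / (1 + |z|²)⁴`, hence the exponent `4`.
  · refine IntegrableOn.congr_fun ((integrableOn_radD hU hz1 he (n := 4) (by norm_num)).const_mul 4)
      (fun x hx => ?_) hU.measurableSet
    simp only [fluxField_eq (northDomain_mem_nhds hx)]
    have := one_add_sq_pos (z x)
    field_simp
    ring

/-! ### Integration by parts in the south and matching on the circle -/

theorem unitDisk_ae_eq : (unitDisk : Set Plane) =ᵐ[volume] {x : Plane | 0 < ‖x‖ ∧ ‖x‖ < 1} := by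
  refine ae_eq_set.2 ⟨measure_mono_null (t := {0}) (fun x hx => ?_) (measure_singleton _), ?_⟩
  · by_contra h0
    exact hx.2 ⟨norm_pos_iff.2 h0, by simpa [unitDisk] using hx.1⟩
  · rw [Set.sdiff_eq_empty.2, measure_empty]
    intro x hx
    simpa [unitDisk] using hx.2

section Disk

variable {s : Plane → ℂ}

theorem closedBall_mem_nhds {x : Plane} (hx : x ∈ unitDisk) : Metric.closedBall (0 : Plane) 1 ∈ 𝓝 x :=
  mem_of_superset (Metric.isOpen_ball.mem_nhds hx) Metric.ball_subset_closedBall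

theorem uniqueDiffOn_closedBall : UniqueDiffOn ℝ (Metric.closedBall (0 : Plane) 1) :=
  uniqueDiffOn_convex (convex_closedBall _ _) ⟨0, by
    rw [interior_closedBall _ one_ne_zero]; simp⟩

theorem integrableOn_unitDisk_of_eq {f g : Plane → ℝ}
    (hg : ContinuousOn g (Metric.closedBall 0 1)) (h : ∀ x ∈ unitDisk, g x = f x) :
    IntegrableOn f unitDisk :=
  ((hg.integrableOn_compact (isCompact_closedBall _ _)).mono_set
    Metric.ball_subset_closedBall).congr_fun h measurableSet_ball

theorem cD_eq_fderivWithin {K : Set Plane} {x : Plane} (hx : K ∈ 𝓝 x) (i : Fin 2) :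
    fderivWithin ℝ s K x (EuclideanSpace.single i 1) = cD i s x := by
  rw [fderivWithin_of_mem_nhds hx, cD]

theorem cD_cD_eq_fderivWithin {K : Set Plane} {x : Plane} (hx : K ∈ 𝓝 x) (i : Fin 2) :
    fderivWithin ℝ (fun y => fderivWithin ℝ s K y (EuclideanSpace.single i 1)) K x
      (EuclideanSpace.single i 1) = cD i (cD i s) x := by
  have he : (fun y => fderivWithin ℝ s K y (EuclideanSpace.single i 1)) =ᶠ[𝓝 x] cD i s := by
    filter_upwards [eventually_mem_nhds_iff.2 hx] with y hy using cD_eq_fderivWithin hy i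
  rw [fderivWithin_of_mem_nhds hx, he.fderiv_eq, cD]

/-- Integration by parts for the southern energy. -/
theorem energyS_eq_energyByParts (hs : ContDiffOn ℝ 2 s (Metric.closedBall 0 1)) :
    energyS s = energyByParts unitDisk s + circleTerm (Metric.closedBall 0 1) s := by
  set K := Metric.closedBall (0 : Plane) 1 with hK
  have hu : UniqueDiffOn ℝ K := uniqueDiffOn_closedBall
  have hs2 : ∀ x ∈ unitDisk, ContDiffAt ℝ 2 s x := fun x hx => hs.contDiffAt (closedBall_mem_nhds hx)
  have hs1 : ∀ x ∈ unitDisk, DifferentiableAt ℝ s x := fun x hx =>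
    (hs2 x hx).differentiableAt (by norm_num)
  have hd1 := fun i : Fin 2 => continuousOn_fderivWithin_apply hu hs (EuclideanSpace.single i 1)
  have hc1 := fun i => (hd1 i).continuousOn
  have hc2 := fun i => ((hd1 i).continuousOn_fderivWithin hu (by norm_num)).clm_apply
    (continuousOn_const (c := EuclideanSpace.single i (1 : ℝ)))
  have hN := continuousOn_one_add_normSq hs.continuousOn
  have hconj : ContinuousOn (fun x => (starRingEnd ℂ) (s x)) K :=
    Complex.continuous_conj.comp_continuousOn hs.continuousOn
  have hre : ∀ {f : Plane → ℂ}, ContinuousOn f K → ContinuousOn (fun x => (f x).re) K :=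
    fun hf => Complex.continuous_re.comp_continuousOn hf
  -- No equation is available for `s`. Instead each integrand agrees on the open disk with an
  -- expression in `fderivWithin` that is continuous on the compact closed disk.
  have he : IntegrableOn (energyDensity s) unitDisk := by
    refine integrableOn_unitDisk_of_eq ((continuousOn_const (c := (2 : ℝ)).mul
      (((hc1 0).norm.pow 2).add ((hc1 1).norm.pow 2))).div (hN.pow 2)
      fun x _ => (pow_pos (one_add_sq_pos _) 2).ne') fun x hx => ?_
    simp only [Pi.mul_apply, Pi.div_apply, Pi.add_apply, Pi.pow_apply,
      energyDensity_eq (hs1 x hx), cD_eq_fderivWithin (closedBall_mem_nhds hx), hK]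
  have hF : IntegrableOn (partsFirst s) unitDisk := by
    refine integrableOn_unitDisk_of_eq ((continuousOn_const (c := (-8 : ℝ)).mul
      (((hre (hconj.mul (hc1 0))).pow 2).add ((hre (hconj.mul (hc1 1))).pow 2))).div (hN.pow 3)
      fun x _ => (pow_pos (one_add_sq_pos _) 3).ne') fun x hx => ?_
    simp only [Pi.mul_apply, Pi.div_apply, Pi.add_apply, Pi.pow_apply,
      partsFirst_eq (hs1 x hx), radD, cD_eq_fderivWithin (closedBall_mem_nhds hx), hK]
  have hS : IntegrableOn (partsSecond s) unitDisk := by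
    refine integrableOn_unitDisk_of_eq ((continuousOn_const (c := (2 : ℝ)).mul
      (hre (hconj.mul ((hc2 0).add (hc2 1))))).div (hN.pow 2)
      fun x _ => (pow_pos (one_add_sq_pos _) 2).ne') fun x hx => ?_
    simp only [Pi.mul_apply, Pi.div_apply, Pi.add_apply, Pi.pow_apply,
      partsSecond_eq (hs2 x hx), cLap, cD_cD_eq_fderivWithin (closedBall_mem_nhds hx), hK]
  have hdiv : ∀ x ∈ unitDisk, partialD 0 (fluxField K 0 s) x + partialD 1 (fluxField K 1 s) x
      = energyDensity s x + partsFirst s x + partsSecond s x := fun x hx =>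
    div_fluxField (closedBall_mem_nhds hx) (hs2 x hx)
  have hsub : {x : Plane | 0 ≤ ‖x‖ ∧ ‖x‖ ≤ 1} ⊆ K := fun x hx => by simpa [hK] using hx.2
  have hmem : ∀ x : Plane, ‖x‖ < 1 → x ∈ unitDisk := fun x hx => by simpa [unitDisk] using hx
  have heF : IntegrableOn (fun x => energyDensity s x + partsFirst s x) unitDisk := he.add hF
  have hint : IntegrableOn (fun x => energyDensity s x + partsFirst s x + partsSecond s x)
      unitDisk := heF.add hS
  have h := integral_div_annulus le_rfl zero_le_one
    ((continuousOn_fluxField hu hs 0).mono hsub) ((continuousOn_fluxField hu hs 1).mono hsub)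
    (fun x _ hx => differentiableAt_fluxField (closedBall_mem_nhds (hmem x hx))
      (hs2 x (hmem x hx)) 0)
    (fun x _ hx => differentiableAt_fluxField (closedBall_mem_nhds (hmem x hx))
      (hs2 x (hmem x hx)) 1)
    ((hint.congr_fun (fun x hx => (hdiv x hx).symm) measurableSet_ball).mono_set
      fun x hx => hmem x hx.2)
  have hm : MeasurableSet unitDisk := measurableSet_ball
  rw [← setIntegral_congr_set unitDisk_ae_eq,
    setIntegral_congr_fun (g := fun x => energyDensity s x + partsFirst s x + partsSecond s x)
      hm hdiv, integral_add heF hS, integral_add he hF] at h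
  have h0 : circleTerm K s = flux (fluxField K 0 s) (fluxField K 1 s) 1 := circleTerm_eq_flux K s
  -- The inner circle has radius `0`, so its flux drops out.
  simp only [zero_mul, intervalIntegral.integral_zero, sub_zero] at h
  rw [flux] at h0
  rw [energyS, dirichletEnergy, energyByParts, h0, ← h]
  ring

end Disk

theorem circleTerm_congr {s z : Plane → ℂ} {K L : Set Plane}
    (h : ∀ x ∈ Metric.sphere (0 : Plane) 1, s x = z x ∧ fderivWithin ℝ s K x x = fderivWithin ℝ z L x x) :
    circleTerm K s = circleTerm L z := by
  unfold circleTerm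
  refine intervalIntegral.integral_congr fun θ _ => ?_
  obtain ⟨h1, h2⟩ := h (circlePt θ) (by simp [norm_circlePt])
  simp only [h1, h2]

/-! ### The minimal conditions force a locally constant argument -/

section MinimalConditions

variable {w : Plane → ℂ}

theorem det_eq_zero_of_not_linearIndependent {f g : Plane → ℝ} {x : Plane}
    (h : ¬ LinearIndependent ℝ ![gradient f x, gradient g x]) :
    partialD 0 f x * partialD 1 g x - partialD 1 f x * partialD 0 g x = 0 := by
  rw [LinearIndependent.pair_iff] at h
  push Not at h
  obtain ⟨s, t, hst, hne⟩ := h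
  have hi : ∀ i, s * partialD i f x + t * partialD i g x = 0 := fun i => by
    simpa [gradient_apply] using congrArg (fun v : Plane => v i) hst
  have h0 := hi 0
  have h1 := hi 1
  by_cases hs : s = 0
  · have ht : t ≠ 0 := hne hs
    apply mul_left_cancel₀ ht
    linear_combination partialD 0 f x * h1 - partialD 1 f x * h0
  · apply mul_left_cancel₀ hs
    linear_combination partialD 1 g x * h0 - partialD 0 g x * h1

/-- The minimal conditions, in terms of the complex partial derivatives. -/
theorem minimalConditions_eq {x : Plane} (hw : DifferentiableAt ℝ w x)
    (h : MinimalConditionsAt (uPart w) (vPart w) x) :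
    (w x).re ^ 2 * ((cD 0 w x).im ^ 2 + (cD 1 w x).im ^ 2)
        - (w x).im ^ 2 * ((cD 0 w x).re ^ 2 + (cD 1 w x).re ^ 2) = 0 ∧
      (cD 0 w x).re * (cD 1 w x).im - (cD 1 w x).re * (cD 0 w x).im = 0 := by
  obtain ⟨h1, h2⟩ := h
  have h3 := det_eq_zero_of_not_linearIndependent h2
  rw [norm_gradient_sq, norm_gradient_sq] at h1
  simp only [partialD_uPart hw, partialD_vPart hw, uPart, vPart] at h1 h3
  exact ⟨by linarith, h3⟩

theorem eqOn_zero_of_ae {f : Plane → ℝ} {U : Set Plane} (hU : IsOpen U) (hf : ContinuousOn f U)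
    (h : ∀ᵐ x ∂(volume.restrict U), f x = 0) : ∀ x ∈ U, f x = 0 := fun _ hx =>
  Measure.eqOn_open_of_ae_eq (μ := volume) h hU hf continuousOn_const hx

/-- Both conditions imply polynomial identities in `w` and its first derivatives. These are
continuous, so validity almost everywhere on an open set gives validity everywhere. -/
theorem minimalConditions_everywhere {U : Set Plane} (hU : IsOpen U) (hw : ContDiffOn ℝ 1 w U)
    (h : ∀ᵐ x ∂(volume.restrict U), MinimalConditionsAt (uPart w) (vPart w) x) :
    ∀ x ∈ U, (w x).re ^ 2 * ((cD 0 w x).im ^ 2 + (cD 1 w x).im ^ 2)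
        - (w x).im ^ 2 * ((cD 0 w x).re ^ 2 + (cD 1 w x).re ^ 2) = 0 ∧
      (cD 0 w x).re * (cD 1 w x).im - (cD 1 w x).re * (cD 0 w x).im = 0 := by
  have hre : ∀ {f : Plane → ℂ}, ContinuousOn f U → ContinuousOn (fun x => (f x).re) U :=
    fun hf => Complex.continuous_re.comp_continuousOn hf
  have him : ∀ {f : Plane → ℂ}, ContinuousOn f U → ContinuousOn (fun x => (f x).im) U :=
    fun hf => Complex.continuous_im.comp_continuousOn hf
  have hD := continuousOn_cD hU hw
  have hae := (h.and (ae_restrict_mem hU.measurableSet)).mono fun x hx =>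
    minimalConditions_eq ((hw.contDiffAt (hU.mem_nhds hx.2)).differentiableAt (by norm_num)) hx.1
  intro x hx
  constructor
  · refine eqOn_zero_of_ae (f := fun x => (w x).re ^ 2 * ((cD 0 w x).im ^ 2 + (cD 1 w x).im ^ 2)
        - (w x).im ^ 2 * ((cD 0 w x).re ^ 2 + (cD 1 w x).re ^ 2)) hU ?_ (hae.mono fun x h => h.1) x hx
    exact (((hre hw.continuousOn).pow 2).mul (((him (hD 0)).pow 2).add ((him (hD 1)).pow 2))).sub
      (((him hw.continuousOn).pow 2).mul (((hre (hD 0)).pow 2).add ((hre (hD 1)).pow 2)))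
  · refine eqOn_zero_of_ae (f := fun x => (cD 0 w x).re * (cD 1 w x).im
      - (cD 1 w x).re * (cD 0 w x).im) hU ?_ (hae.mono fun x h => h.2) x hx
    exact ((hre (hD 0)).mul (him (hD 1))).sub ((hre (hD 1)).mul (him (hD 0)))

/-- A solution of the Euler–Lagrange equation with real `∂ᵢ(w²)` near a point has
`Im ∑ (∂ᵢ w)² = 0` there. -/
theorem im_sum_sq_eq_zero {x : Plane} (hw : ContDiffAt ℝ 2 w x) (hEL : ComplexEL w x)
    (h : ∀ᶠ y in 𝓝 x, ∀ i, (w y * cD i w y).im = 0) :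
    (cD 0 w x ^ 2 + cD 1 w x ^ 2).im = 0 := by
  have hd := hw.differentiableAt (by norm_num)
  -- Differentiate `Im (w ∂ᵢ w) = 0` once more in direction `i`.
  have hi : ∀ i, (cD i w x ^ 2 + w x * cD i (cD i w) x).im = 0 := by
    intro i
    have hd' := (contDiffAt_cD hw i).differentiableAt (by norm_num)
    have h1 := Complex.imCLM.hasFDerivAt.comp_hasDerivAt (0 : ℝ)
      ((hasDerivAt_line hd i).fun_mul (hasDerivAt_line hd' i))
    have hline : Tendsto (fun t : ℝ => x + t • EuclideanSpace.single i (1 : ℝ)) (𝓝 0) (𝓝 x) := by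
      have : Continuous fun t : ℝ => x + t • EuclideanSpace.single i (1 : ℝ) := by fun_prop
      simpa using this.tendsto 0
    have h2 : HasDerivAt (fun _ : ℝ => (0 : ℝ)) _ 0 := h1.congr_of_eventuallyEq
      ((hline.eventually h).mono fun t ht => (ht i).symm)
    have h3 := h2.unique (hasDerivAt_const _ _)
    simp only [zero_smul, add_zero, Complex.imCLM_apply] at h3
    rw [← h3]
    congr 1
    ring
  have hN := one_add_sq_pos (w x)
  set S := cD 0 w x ^ 2 + cD 1 w x ^ 2 with hS
  have h4 : S.im + (w x * cLap w x).im = 0 := by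
    have e : S + w x * cLap w x = (cD 0 w x ^ 2 + w x * cD 0 (cD 0 w) x)
        + (cD 1 w x ^ 2 + w x * cD 1 (cD 1 w) x) := by rw [hS, cLap]; ring
    rw [← Complex.add_im, e, Complex.add_im, hi 0, hi 1, add_zero]
  -- The equation gives `(1 + |w|²) w Δw = 2 |w|² S`. With `Im S + Im (w Δw) = 0` this yields `(1 +
  -- 3 |w|²) Im S = 0`.
  have h5 : (w x * cLap w x).im * (1 + ‖w x‖ ^ 2) = 2 * ‖w x‖ ^ 2 * S.im := by
    rw [← Complex.im_mul_ofReal, mul_assoc, hEL]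
    have : w x * (2 * (starRingEnd ℂ) (w x) * S) = ((2 * ‖w x‖ ^ 2 : ℝ) : ℂ) * S := by
      have := Complex.mul_conj (w x)
      rw [← Complex.sq_norm] at this
      push_cast at this ⊢
      linear_combination 2 * S * this
    rw [this, Complex.im_ofReal_mul]
  have h6 : S.im * (1 + 3 * ‖w x‖ ^ 2) = 0 := by linear_combination (1 + ‖w x‖ ^ 2) * h4 - h5
  exact (mul_eq_zero.1 h6).resolve_right (by positivity)

/-- Under the minimal conditions, the argument of a solution is locally constant. -/
theorem angD_eq_zero_of_minimal {U : Set Plane} (hU : IsOpen U) (hw : ContDiffOn ℝ 2 w U)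
    (hEL : ∀ x ∈ U, ComplexEL w x)
    (h : ∀ᵐ x ∂(volume.restrict U), MinimalConditionsAt (uPart w) (vPart w) x) :
    ∀ x ∈ U, angD 0 w x ^ 2 + angD 1 w x ^ 2 = 0 := by
  have hw1 : ContDiffOn ℝ 1 w U := hw.of_le (by norm_num)
  have hmin := minimalConditions_everywhere hU hw1 h
  have hA := continuousOn_angD hU hw1
  have hcont : ContinuousOn (fun x => angD 0 w x ^ 2 + angD 1 w x ^ 2) U :=
    ((hA 0).pow 2).add ((hA 1).pow 2)
  intro x hx
  by_contra hne
  have hev : ∀ᶠ y in 𝓝 x, y ∈ U ∧ angD 0 w y ^ 2 + angD 1 w y ^ 2 ≠ 0 :=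
    (hU.eventually_mem hx).and ((hcont.continuousAt (hU.mem_nhds hx)).eventually_ne hne)
  have hzero : ∀ᶠ y in 𝓝 x, ∀ i, (w y * cD i w y).im = 0 := by
    filter_upwards [hev] with y hy
    obtain ⟨h1, h2⟩ := hmin y hy.1
    -- With `a = u ∇v` and `b = v ∇u` this is `|a - b|² |a + b|² = (|a|² - |b|²)² + 4 (a × b)²`,
    -- whose right side vanishes by the minimal conditions. So wherever `angD ≠ 0` one has `a + b =
    -- 0`, that is, `uv` has zero gradient.
    have h3 : (angD 0 w y ^ 2 + angD 1 w y ^ 2)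
        * ((w y * cD 0 w y).im ^ 2 + (w y * cD 1 w y).im ^ 2) = 0 := by
      rw [angD_eq, angD_eq, Complex.mul_im, Complex.mul_im]
      set u := (w y).re
      set v := (w y).im
      set r0 := (cD 0 w y).re
      set r1 := (cD 1 w y).re
      set m0 := (cD 0 w y).im
      set m1 := (cD 1 w y).im
      linear_combination (u ^ 2 * (m0 ^ 2 + m1 ^ 2) - v ^ 2 * (r0 ^ 2 + r1 ^ 2)) * h1
        + (4 * u ^ 2 * v ^ 2 * (r0 * m1 - r1 * m0)) * h2
    have h4 := (mul_eq_zero.1 h3).resolve_left hy.2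
    refine Fin.forall_fin_two.2 ⟨?_, ?_⟩
    · exact pow_eq_zero_iff two_ne_zero |>.1 (by
        linarith [sq_nonneg (w y * cD 0 w y).im, sq_nonneg (w y * cD 1 w y).im])
    · exact pow_eq_zero_iff two_ne_zero |>.1 (by
        linarith [sq_nonneg (w y * cD 0 w y).im, sq_nonneg (w y * cD 1 w y).im])
  have him := im_sum_sq_eq_zero (hw.contDiffAt (hU.mem_nhds hx)) (hEL x hx) hzero
  obtain ⟨h1, h2⟩ := hmin x hx
  apply hne
  rw [angD_eq, angD_eq]
  simp only [pow_two, Complex.add_im, Complex.mul_im] at him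
  set u := (w x).re
  set v := (w x).im
  set r0 := (cD 0 w x).re
  set r1 := (cD 1 w x).re
  set m0 := (cD 0 w x).im
  set m1 := (cD 1 w x).im
  -- The equation has now made `∇u` and `∇v` orthogonal. They are also parallel, so one of them
  -- vanishes (`h4`, Lagrange's identity); then `u²|∇v|² = v²|∇u|²` makes both of these products
  -- zero, and `angD = 0`, contrary to the choice of `x`.
  have h3 : r0 * m0 + r1 * m1 = 0 := by linarith
  have h4 : (r0 ^ 2 + r1 ^ 2) * (m0 ^ 2 + m1 ^ 2) = 0 := by
    linear_combination (r0 * m0 + r1 * m1) * h3 + (r0 * m1 - r1 * m0) * h2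
  have h5 : (u ^ 2 * (m0 ^ 2 + m1 ^ 2)) ^ 2 = 0 := by
    linear_combination u ^ 2 * (m0 ^ 2 + m1 ^ 2) * h1 + u ^ 2 * v ^ 2 * h4
  have h6 : u ^ 2 * (m0 ^ 2 + m1 ^ 2) = 0 := pow_eq_zero_iff two_ne_zero |>.1 h5
  linear_combination 2 * h6 - h1 - 2 * u * v * h3

end MinimalConditions

/-! ### Minimality through the harmonic function `2 arctan |w|` -/

section Calibration

/-- A smoothing of the spherical distance `2 arctan |η|` to the pole. -/
noncomputable def poleDist (c : ℝ) (η : Plane → ℂ) (x : Plane) : ℝ :=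
  2 * Real.arctan (√(‖η x‖ ^ 2 + c))

variable {η w : Plane → ℂ}

theorem continuousOn_poleDist (c : ℝ) {K : Set Plane} (h : ContinuousOn η K) :
    ContinuousOn (poleDist c η) K :=
  continuousOn_const.mul (Real.continuous_arctan.comp_continuousOn
    (Real.continuous_sqrt.comp_continuousOn ((h.norm.pow 2).add continuousOn_const)))

theorem differentiableAt_poleDist {c : ℝ} {x : Plane} (h : DifferentiableAt ℝ η x)
    (hpos : 0 < ‖η x‖ ^ 2 + c) : DifferentiableAt ℝ (poleDist c η) x :=
  (((differentiableAt_normSq h).add_const c).sqrt hpos.ne').arctan.const_mul 2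

theorem partialD_poleDist {c : ℝ} {x : Plane} (h : DifferentiableAt ℝ η x)
    (hpos : 0 < ‖η x‖ ^ 2 + c) (i : Fin 2) :
    partialD i (poleDist c η) x
      = 2 * radD i η x / (√(‖η x‖ ^ 2 + c) * (1 + (‖η x‖ ^ 2 + c))) := by
  refine fderiv_apply_eq (differentiableAt_poleDist h hpos) ?_
  have h1 := ((((hasDerivAt_line_normSq h i).add_const c).sqrt
    (by simpa using hpos.ne')).arctan).const_mul 2
  refine h1.congr_deriv ?_
  have hr : ((starRingEnd ℂ) (η x) * cD i η x).re = radD i η x := rfl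
  have hs : 0 < √(‖η x‖ ^ 2 + c) := Real.sqrt_pos.2 hpos
  simp only [zero_smul, add_zero, hr, Real.sq_sqrt hpos.le]
  have : 1 + (‖η x‖ ^ 2 + c) ≠ 0 := by positivity
  field_simp

/-- The distance to the pole is 1-Lipschitz on the sphere, and the smoothing by `c ≥ 0` does not
increase its gradient. The factor `2` appears because the energy density is half the squared
differential in the round metric. -/
theorem sum_sq_partialD_poleDist_le {c : ℝ} (hc : 0 ≤ c) {x : Plane} (h : DifferentiableAt ℝ η x)
    (hpos : 0 < ‖η x‖ ^ 2 + c) :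
    partialD 0 (poleDist c η) x ^ 2 + partialD 1 (poleDist c η) x ^ 2 ≤ 2 * energyDensity η x := by
  rw [partialD_poleDist h hpos, partialD_poleDist h hpos, energyDensity_eq h, div_pow, div_pow,
    mul_pow, mul_pow, mul_pow, Real.sq_sqrt hpos.le, ← add_div]
  have hR := radD_sq_add_le η x
  set G := ‖cD 0 η x‖ ^ 2 + ‖cD 1 η x‖ ^ 2 with hG
  have hG0 : 0 ≤ G := by positivity
  have hN := one_add_sq_pos (η x)
  have e : 2 * (2 * G / (1 + ‖η x‖ ^ 2) ^ 2) = 4 * G / (1 + ‖η x‖ ^ 2) ^ 2 := by ring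
  rw [e, div_le_div_iff₀ (by positivity) (by positivity)]
  have h1 : 2 ^ 2 * radD 0 η x ^ 2 + 2 ^ 2 * radD 1 η x ^ 2 ≤ 4 * G * (‖η x‖ ^ 2 + c) := by
    nlinarith
  have h2 : (1 + ‖η x‖ ^ 2) ^ 2 ≤ (1 + (‖η x‖ ^ 2 + c)) ^ 2 := by gcongr; linarith
  calc _ ≤ 4 * G * (‖η x‖ ^ 2 + c) * (1 + (‖η x‖ ^ 2 + c)) ^ 2 := by gcongr
    _ = _ := by ring

theorem continuousOn_partialD_poleDist {c : ℝ} {U : Set Plane} (hU : IsOpen U)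
    (h : ContDiffOn ℝ 1 η U) (hpos : ∀ x ∈ U, 0 < ‖η x‖ ^ 2 + c) (i : Fin 2) :
    ContinuousOn (partialD i (poleDist c η)) U := by
  have hs : ContinuousOn (fun x => ‖η x‖ ^ 2 + c) U :=
    (h.continuousOn.norm.pow 2).add continuousOn_const
  refine ContinuousOn.congr (f := fun x =>
    2 * radD i η x / (√(‖η x‖ ^ 2 + c) * (1 + (‖η x‖ ^ 2 + c)))) ?_ fun x hx =>
    partialD_poleDist ((h.contDiffAt (hU.mem_nhds hx)).differentiableAt (by norm_num)) (hpos x hx) i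
  refine (continuousOn_const.mul (continuousOn_radD hU h i)).div
    ((Real.continuous_sqrt.comp_continuousOn hs).mul (continuousOn_const.add hs)) fun x hx => ?_
  have := hpos x hx
  have : 0 < √(‖η x‖ ^ 2 + c) := Real.sqrt_pos.2 this
  have : 0 < 1 + (‖η x‖ ^ 2 + c) := by linarith [hpos x hx]
  positivity

/-- The gradient of `2 arctan |w|`, with derivatives taken from inside `K`. -/
noncomputable def poleField (K : Set Plane) (i : Fin 2) (w : Plane → ℂ) (x : Plane) : ℝ :=
  2 * ((starRingEnd ℂ) (w x) * fderivWithin ℝ w K x (EuclideanSpace.single i 1)).re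
    / (‖w x‖ * (1 + ‖w x‖ ^ 2))

theorem continuousOn_poleField {K : Set Plane} (hK : UniqueDiffOn ℝ K)
    (hw : ContDiffOn ℝ 2 w K) (h0 : ∀ x ∈ K, w x ≠ 0) (i : Fin 2) :
    ContinuousOn (poleField K i w) K := by
  have h1 := (continuousOn_fderivWithin_apply hK hw (EuclideanSpace.single i 1)).continuousOn
  have h3 : ContinuousOn (fun x => (starRingEnd ℂ) (w x)) K :=
    Complex.continuous_conj.comp_continuousOn hw.continuousOn
  have h4 : ContinuousOn (fun x => ((starRingEnd ℂ) (w x)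
      * fderivWithin ℝ w K x (EuclideanSpace.single i 1)).re) K :=
    Complex.continuous_re.comp_continuousOn (h3.mul h1)
  exact (continuousOn_const.mul h4).div
    (hw.continuousOn.norm.mul (continuousOn_one_add_normSq hw.continuousOn))
    fun x hx => mul_ne_zero (norm_ne_zero_iff.2 (h0 x hx)) (one_add_sq_pos (w x)).ne'

theorem poleField_eq {K : Set Plane} {x : Plane} (hx : K ∈ 𝓝 x) (i : Fin 2) :
    poleField K i w x = 2 * radD i w x / (‖w x‖ * (1 + ‖w x‖ ^ 2)) := by
  rw [poleField, fderivWithin_of_mem_nhds hx, radD, cD]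

theorem partialD_poleDist_zero {K : Set Plane} {x : Plane} (hx : K ∈ 𝓝 x)
    (hw : DifferentiableAt ℝ w x) (h0 : w x ≠ 0) (i : Fin 2) :
    partialD i (poleDist 0 w) x = poleField K i w x := by
  have hn : 0 < ‖w x‖ := norm_pos_iff.2 h0
  rw [partialD_poleDist hw (by positivity), poleField_eq hx, add_zero, Real.sqrt_sq hn.le]

theorem poleField_eventuallyEq {K : Set Plane} {x : Plane} (hx : K ∈ 𝓝 x) (i : Fin 2) :
    poleField K i w =ᶠ[𝓝 x] fun y => 2 * radD i w y / (‖w y‖ * (1 + ‖w y‖ ^ 2)) := by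
  filter_upwards [eventually_mem_nhds_iff.2 hx] with y hy using poleField_eq hy i

theorem differentiableAt_poleField {K : Set Plane} {x : Plane} (hx : K ∈ 𝓝 x)
    (hw : ContDiffAt ℝ 2 w x) (h0 : w x ≠ 0) (i : Fin 2) :
    DifferentiableAt ℝ (poleField K i w) x := by
  have hd := hw.differentiableAt (by norm_num)
  refine DifferentiableAt.congr_of_eventuallyEq ?_ (poleField_eventuallyEq hx i)
  have h1 : DifferentiableAt ℝ (fun y => ‖w y‖ * (1 + ‖w y‖ ^ 2)) x :=
    (hd.norm ℝ h0).fun_mul ((differentiableAt_normSq hd).const_add 1)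
  have h2 : ‖w x‖ * (1 + ‖w x‖ ^ 2) ≠ 0 :=
    mul_ne_zero (norm_ne_zero_iff.2 h0) (one_add_sq_pos (w x)).ne'
  simpa only [div_eq_mul_inv] using ((differentiableAt_radD hw i).const_mul 2).fun_mul
    (h1.fun_inv h2)

theorem hasDerivAt_line_norm {x : Plane} (hw : DifferentiableAt ℝ w x) (h0 : w x ≠ 0) (i : Fin 2) :
    HasDerivAt (fun t : ℝ => ‖w (x + t • EuclideanSpace.single i (1 : ℝ))‖)
      (radD i w x / ‖w x‖) 0 := by
  have hn : 0 < ‖w x‖ := norm_pos_iff.2 h0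
  have h := (hasDerivAt_line_normSq hw i).sqrt (by simpa using h0)
  simp only [Real.sqrt_sq (norm_nonneg _), zero_smul, add_zero] at h
  refine h.congr_deriv ?_
  rw [radD]
  field_simp

theorem partialD_poleField {K : Set Plane} {x : Plane} (hx : K ∈ 𝓝 x)
    (hw : ContDiffAt ℝ 2 w x) (h0 : w x ≠ 0) (i : Fin 2) :
    partialD i (poleField K i w) x
      = 2 * (‖cD i w x‖ ^ 2 + ((starRingEnd ℂ) (w x) * cD i (cD i w) x).re)
          / (‖w x‖ * (1 + ‖w x‖ ^ 2))
        - 2 * (1 + 3 * ‖w x‖ ^ 2) * radD i w x ^ 2 / (‖w x‖ ^ 3 * (1 + ‖w x‖ ^ 2) ^ 2) := by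
  have hd := hw.differentiableAt (by norm_num)
  have hn : 0 < ‖w x‖ := norm_pos_iff.2 h0
  have hN := one_add_sq_pos (w x)
  have hdf := differentiableAt_poleField hx hw h0 i
  rw [partialD, (poleField_eventuallyEq hx i).fderiv_eq]
  refine fderiv_apply_eq (hdf.congr_of_eventuallyEq (poleField_eventuallyEq hx i).symm) ?_
  have h1 := (hasDerivAt_line_norm hd h0 i).fun_mul ((hasDerivAt_line_normSq hd i).const_add 1)
  have h := ((hasDerivAt_line_radD hw i).const_mul 2).fun_div h1
    (by simp only [zero_smul, add_zero]; positivity)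
  refine h.congr_deriv ?_
  have hr : ((starRingEnd ℂ) (w x) * cD i w x).re = radD i w x := rfl
  simp only [zero_smul, add_zero, hr]
  field_simp
  ring

/-- The function `2 arctan |w|` is harmonic if the argument of the solution `w` is constant. -/
theorem div_poleField_eq_zero {K : Set Plane} {x : Plane} (hx : K ∈ 𝓝 x)
    (hw : ContDiffAt ℝ 2 w x) (h0 : w x ≠ 0) (hEL : ComplexEL w x)
    (hang : angD 0 w x ^ 2 + angD 1 w x ^ 2 = 0) :
    partialD 0 (poleField K 0 w) x + partialD 1 (poleField K 1 w) x = 0 := by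
  have hn : 0 < ‖w x‖ := norm_pos_iff.2 h0
  have hN := one_add_sq_pos (w x)
  -- The radial component of the equation; with the angular part zero it is exactly the Laplace
  -- equation for `2 arctan |w|`.
  have h2 : ((starRingEnd ℂ) (w x) * cLap w x).re * (1 + ‖w x‖ ^ 2)
      = 2 * ((starRingEnd ℂ) (w x) ^ 2 * (cD 0 w x ^ 2 + cD 1 w x ^ 2)).re := by
    rw [← Complex.re_mul_ofReal, mul_assoc, hEL, ← Complex.re_ofReal_mul]
    congr 1; push_cast; ring
  rw [mul_add ((starRingEnd ℂ) (w x) ^ 2), Complex.add_re, re_conj_sq_mul_sq, re_conj_sq_mul_sq,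
    cLap, mul_add ((starRingEnd ℂ) (w x)), Complex.add_re] at h2
  have h3 := radD_sq_add_angD_sq 0 w x
  have h4 := radD_sq_add_angD_sq 1 w x
  rw [partialD_poleField hx hw h0, partialD_poleField hx hw h0]
  field_simp
  linear_combination 2 * ‖w x‖ ^ 2 * h2 - 2 * (1 + ‖w x‖ ^ 2) * (h3 + h4)
    + 2 * (1 - ‖w x‖ ^ 2) * hang

theorem sum_sq_poleField_le {K : Set Plane} {x : Plane} (hx : K ∈ 𝓝 x)
    (hw : DifferentiableAt ℝ w x) (h0 : w x ≠ 0) :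
    poleField K 0 w x ^ 2 + poleField K 1 w x ^ 2 ≤ 2 * energyDensity w x := by
  have hn : 0 < ‖w x‖ := norm_pos_iff.2 h0
  rw [← partialD_poleDist_zero hx hw h0, ← partialD_poleDist_zero hx hw h0]
  exact sum_sq_partialD_poleDist_le le_rfl hw (by positivity)

/-- Equality in the gradient bound: without angular motion the whole differential is seen by the
distance to the pole. -/
theorem sum_sq_poleField_eq {K : Set Plane} {x : Plane} (hx : K ∈ 𝓝 x)
    (hw : DifferentiableAt ℝ w x) (h0 : w x ≠ 0)
    (hang : angD 0 w x ^ 2 + angD 1 w x ^ 2 = 0) :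
    poleField K 0 w x ^ 2 + poleField K 1 w x ^ 2 = 2 * energyDensity w x := by
  have hn : 0 < ‖w x‖ := norm_pos_iff.2 h0
  have hN := one_add_sq_pos (w x)
  have h3 := radD_sq_add_angD_sq 0 w x
  have h4 := radD_sq_add_angD_sq 1 w x
  rw [poleField_eq hx, poleField_eq hx, energyDensity_eq hw]
  field_simp
  linear_combination h3 + h4 - hang

theorem arctan_sub_le {a b : ℝ} (h : a ≤ b) : Real.arctan b - Real.arctan a ≤ b - a := by
  have h1 := convex_univ.image_sub_le_mul_sub_of_deriv_le (f := Real.arctan) (C := 1)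
    Real.continuous_arctan.continuousOn Real.differentiable_arctan.differentiableOn
    (fun x _ => by
      rw [Real.deriv_arctan]
      exact (div_le_one (by positivity)).2 (by nlinarith [sq_nonneg x])) a (mem_univ _) b
    (mem_univ _) h
  linarith

/-- The smoothing moves the modulus by at most `ε`, and `arctan` is 1-Lipschitz. It controls the
boundary flux, where `η` and `w` agree. -/
theorem abs_poleDist_sub_le {ε : ℝ} (hε : 0 ≤ ε) {x : Plane} (h : η x = w x) :
    |poleDist (ε ^ 2) η x - poleDist 0 w x| ≤ 2 * ε := by
  have h1 : √(‖w x‖ ^ 2 + ε ^ 2) ≤ ‖w x‖ + ε := by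
    rw [Real.sqrt_le_left (by positivity)]
    nlinarith [norm_nonneg (w x), mul_nonneg (norm_nonneg (w x)) hε]
  have h2 : ‖w x‖ ≤ √(‖w x‖ ^ 2 + ε ^ 2) := Real.le_sqrt_of_sq_le (by nlinarith [sq_nonneg ε])
  have h3 := arctan_sub_le h2
  have h4 := Real.arctan_mono h2
  rw [poleDist, poleDist, h, add_zero, Real.sqrt_sq (norm_nonneg _), abs_of_nonneg (by linarith)]
  linarith

theorem abs_poleDist_sub_le_two_pi (c : ℝ) (x : Plane) :
    |poleDist c η x - poleDist 0 w x| ≤ 2 * Real.pi := by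
  have h1 := Real.arctan_lt_pi_div_two (√(‖η x‖ ^ 2 + c))
  have h2 := Real.neg_pi_div_two_lt_arctan (√(‖η x‖ ^ 2 + c))
  have h3 := Real.arctan_lt_pi_div_two (√(‖w x‖ ^ 2 + 0))
  have h4 := Real.neg_pi_div_two_lt_arctan (√(‖w x‖ ^ 2 + 0))
  rw [poleDist, poleDist, abs_le]
  constructor <;> linarith

theorem partialD_mul_sub {f g h : Plane → ℝ} {x : Plane} (hf : DifferentiableAt ℝ f x)
    (hg : DifferentiableAt ℝ g x) (hh : DifferentiableAt ℝ h x) (i : Fin 2) :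
    partialD i (fun y => (f y - g y) * h y) x
      = (partialD i f x - partialD i g x) * h x + (f x - g x) * partialD i h x := by
  rw [partialD_mul (hf.fun_sub hg) hh]
  congr 2
  rw [partialD, (hf.hasFDerivAt.fun_sub hg.hasFDerivAt).fderiv]
  rfl

/-- Solutions with constant argument minimize the energy, up to an error from the smoothing. -/
theorem energyN_le_add {ε : ℝ} (hε : 0 < ε) (hw : ContDiffOn ℝ 2 w northDomain)
    (h0 : ∀ x ∈ northDomain, w x ≠ 0) (he : IntegrableOn (energyDensity w) northDomain)
    (hEL : ∀ x ∈ northInterior, ComplexEL w x)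
    (hang : ∀ x ∈ northInterior, angD 0 w x ^ 2 + angD 1 w x ^ 2 = 0)
    (hη : η ∈ competitorsN w) :
    energyN w ≤ energyN η + flux
      (fun x => (poleDist (ε ^ 2) η x - poleDist 0 w x) * poleField northDomain 0 w x)
      (fun x => (poleDist (ε ^ 2) η x - poleDist 0 w x) * poleField northDomain 1 w x) 1 := by
  obtain ⟨hηc, hηd, hηe, -⟩ := hη
  have hU := isOpen_northInterior
  have hK : ∀ x ∈ northInterior, northDomain ∈ 𝓝 x := fun x hx => northDomain_mem_nhds hx
  have hwU := hw.mono northInterior_subset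
  have hw2 : ∀ x ∈ northInterior, ContDiffAt ℝ 2 w x := fun x hx => hwU.contDiffAt (hU.mem_nhds hx)
  have hw1 : ∀ x ∈ northInterior, DifferentiableAt ℝ w x := fun x hx =>
    (hw2 x hx).differentiableAt (by norm_num)
  have hη1 : ∀ x ∈ northInterior, DifferentiableAt ℝ η x := fun x hx =>
    (hηd.contDiffAt (hU.mem_nhds hx)).differentiableAt (by norm_num)
  have h0U : ∀ x ∈ northInterior, w x ≠ 0 := fun x hx => h0 x (northInterior_subset hx)
  have hpη : ∀ x ∈ northInterior, 0 < ‖η x‖ ^ 2 + ε ^ 2 := fun x _ => by positivity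
  have hpw : ∀ x ∈ northInterior, 0 < ‖w x‖ ^ 2 + 0 := fun x hx => by
    have := norm_pos_iff.2 (h0U x hx); positivity
  have hewU := integrableOn_northDomain_iff.1 he
  have heηU := integrableOn_northDomain_iff.1 hηe
  have hY := continuousOn_poleField uniqueDiffOn_northDomain hw h0
  have hYU := fun i => (hY i).mono northInterior_subset
  have hΦ := (continuousOn_poleDist (ε ^ 2) hηc).sub (continuousOn_poleDist 0 hw.continuousOn)
  have hΦd := fun x hx => differentiableAt_poleDist (hη1 x hx) (hpη x hx)
  have hψd := fun x hx => differentiableAt_poleDist (hw1 x hx) (hpw x hx)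
  have hYd := fun i x hx => differentiableAt_poleField (hK x hx) (hw2 x hx) (h0U x hx) i
  have hcη := continuousOn_partialD_poleDist hU hηd hpη
  set X : Fin 2 → Plane → ℝ := fun i x =>
    (poleDist (ε ^ 2) η x - poleDist 0 w x) * poleField northDomain i w x with hX
  set d : Plane → ℝ := fun x =>
    (partialD 0 (poleDist (ε ^ 2) η) x - poleField northDomain 0 w x) * poleField northDomain 0 w x
    + (partialD 1 (poleDist (ε ^ 2) η) x - poleField northDomain 1 w x)
      * poleField northDomain 1 w x with hd
  -- The product rule leaves only `⟨∇(difference), poleField⟩`, because `poleField` is divergence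
  -- free.
  have hdiv : ∀ x ∈ northInterior, partialD 0 (X 0) x + partialD 1 (X 1) x = d x := by
    intro x hx
    have h1 := div_poleField_eq_zero (hK x hx) (hw2 x hx) (h0U x hx) (hEL x hx) (hang x hx)
    simp only [hX]
    rw [partialD_mul_sub (hΦd x hx) (hψd x hx) (hYd 0 x hx),
      partialD_mul_sub (hΦd x hx) (hψd x hx) (hYd 1 x hx),
      partialD_poleDist_zero (hK x hx) (hw1 x hx) (h0U x hx),
      partialD_poleDist_zero (hK x hx) (hw1 x hx) (h0U x hx)]
    linear_combination (poleDist (ε ^ 2) η x - poleDist 0 w x) * h1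
  -- From `(a - p) p ≤ (a² - p²) / 2` and the two gradient estimates. The second bound uses `|a p| ≤
  -- (a² + p²) / 2` and makes `d` integrable.
  have hdle : ∀ x ∈ northInterior, d x ≤ energyDensity η x - energyDensity w x ∧
      |d x| ≤ 1 * (energyDensity η x + 3 * energyDensity w x) := by
    intro x hx
    have h1 := sum_sq_partialD_poleDist_le (sq_nonneg ε) (hη1 x hx) (hpη x hx)
    have h2 := sum_sq_poleField_eq (hK x hx) (hw1 x hx) (h0U x hx) (hang x hx)
    simp only [hd]
    set a := partialD 0 (poleDist (ε ^ 2) η) x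
    set b := partialD 1 (poleDist (ε ^ 2) η) x
    set p := poleField northDomain 0 w x
    set q := poleField northDomain 1 w x
    refine ⟨by nlinarith [sq_nonneg (a - p), sq_nonneg (b - q)], abs_le.2 ⟨?_, ?_⟩⟩
    · nlinarith [sq_nonneg (a + p), sq_nonneg (b + q)]
    · nlinarith [sq_nonneg (a - p), sq_nonneg (b - q)]
  have hdi : IntegrableOn d northInterior := by
    have hew3 : IntegrableOn (fun x => energyDensity η x + 3 * energyDensity w x) northInterior :=
      heηU.add (hewU.const_mul 3)
    exact IntegrableOn.of_continuousOn_of_abs_le hU ((((hcη 0).sub (hYU 0)).mul (hYU 0)).add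
      (((hcη 1).sub (hYU 1)).mul (hYU 1))) hew3 1 fun x hx => (hdle x hx).2
  -- The difference of the two distances is bounded and `poleField` is square integrable by finite
  -- energy, so there is no term at infinity.
  have hX2 : IntegrableOn (fun x => X 0 x ^ 2 + X 1 x ^ 2) northInterior := by
    have hΦU := hΦ.mono northInterior_subset
    refine IntegrableOn.of_continuousOn_of_abs_le hU
      (((hΦU.mul (hYU 0)).pow 2).add ((hΦU.mul (hYU 1)).pow 2)) hewU ((2 * Real.pi) ^ 2 * 2)
      fun x hx => ?_
    have h1 := sum_sq_poleField_le (hK x hx) (hw1 x hx) (h0U x hx)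
    have h2 := sq_le_sq' (abs_le.1 (abs_poleDist_sub_le_two_pi (η := η) (w := w) (ε ^ 2) x)).1
      (abs_le.1 (abs_poleDist_sub_le_two_pi (η := η) (w := w) (ε ^ 2) x)).2
    rw [abs_of_nonneg (by positivity)]
    simp only [hX, mul_pow, ← mul_add]
    calc _ ≤ (2 * Real.pi) ^ 2 * (2 * energyDensity w x) := by
          gcongr
      _ = _ := by ring
  have h := integral_div_northInterior (X := X 0) (Y := X 1) (hΦ.mul (hY 0)) (hΦ.mul (hY 1))
    (fun x hx => ((hΦd x hx).fun_sub (hψd x hx)).fun_mul (hYd 0 x hx))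
    (fun x hx => ((hΦd x hx).fun_sub (hψd x hx)).fun_mul (hYd 1 x hx))
    (hdi.congr_fun (fun x hx => (hdiv x hx).symm) hU.measurableSet) hX2
  rw [setIntegral_congr_fun hU.measurableSet hdiv] at h
  have hmono := setIntegral_mono_on hdi (heηU.sub hewU) hU.measurableSet fun x hx => (hdle x hx).1
  rw [integral_sub' heηU hewU, h] at hmono
  rw [energyN, energyN, dirichletEnergy, dirichletEnergy, integral_northDomain,
    integral_northDomain]
  linarith

/-- Solutions with constant argument minimize the northern energy. -/
theorem isMinOn_energyN (hw : ContDiffOn ℝ 2 w northDomain)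
    (h0 : ∀ x ∈ northDomain, w x ≠ 0) (he : IntegrableOn (energyDensity w) northDomain)
    (hEL : ∀ x ∈ northInterior, ComplexEL w x)
    (hang : ∀ x ∈ northInterior, angD 0 w x ^ 2 + angD 1 w x ^ 2 = 0) :
    IsMinOn energyN (competitorsN w) w := by
  intro η hη
  rw [mem_ofPred_eq]
  have hpc : Continuous fun θ : ℝ => polarPt (1, θ) := continuous_polarPt.comp (by fun_prop)
  have hmem : ∀ θ : ℝ, polarPt (1, θ) ∈ northDomain := fun θ => by
    rw [northDomain_eq, mem_ofPred_eq, norm_polarPt, abs_one]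
  have hbd : ∀ θ : ℝ, η (polarPt (1, θ)) = w (polarPt (1, θ)) := fun θ =>
    hη.2.2.2 _ (by rw [mem_sphere_zero_iff_norm, norm_polarPt, abs_one])
  have hY := fun i => (continuousOn_poleField uniqueDiffOn_northDomain hw h0 i).comp_continuous
    hpc hmem
  set C := ∫ θ in -Real.pi..Real.pi, (|poleField northDomain 0 w (polarPt (1, θ))|
    + |poleField northDomain 1 w (polarPt (1, θ))|) with hC
  have hle : -Real.pi ≤ Real.pi := by linarith [Real.pi_pos]
  have hflux : ∀ ε : ℝ, 0 < ε → energyN w ≤ energyN η + 2 * ε * C := by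
    intro ε hε
    have hΦ := ((continuousOn_poleDist (ε ^ 2) hη.1).sub
      (continuousOn_poleDist 0 hw.continuousOn)).comp_continuous hpc hmem
    have h1 := energyN_le_add hε hw h0 he hEL hang hη
    refine h1.trans (add_le_add le_rfl ?_)
    rw [flux, hC, ← intervalIntegral.integral_const_mul]
    refine intervalIntegral.integral_mono_on hle ?_ ?_ fun θ _ => ?_
    · exact (continuous_const.mul ((Real.continuous_cos.mul (hΦ.mul (hY 0))).add
        (Real.continuous_sin.mul (hΦ.mul (hY 1))))).intervalIntegrable _ _
    · exact (continuous_const.mul ((hY 0).abs.add (hY 1).abs)).intervalIntegrable _ _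
    · have h2 := abs_poleDist_sub_le (η := η) (w := w) hε.le (hbd θ)
      set D := poleDist (ε ^ 2) η (polarPt (1, θ)) - poleDist 0 w (polarPt (1, θ))
      set p := poleField northDomain 0 w (polarPt (1, θ))
      set q := poleField northDomain 1 w (polarPt (1, θ))
      have h3 : ∀ s r : ℝ, |s| ≤ 1 → s * (D * r) ≤ 2 * ε * |r| := fun s r hs => by
        calc s * (D * r) ≤ |s * (D * r)| := le_abs_self _
          _ = |s| * (|D| * |r|) := by rw [abs_mul, abs_mul]
          _ ≤ 1 * (2 * ε * |r|) := by gcongr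
          _ = _ := one_mul _
      have h4 := h3 _ p (Real.abs_cos_le_one θ)
      have h5 := h3 _ q (Real.abs_sin_le_one θ)
      linarith
  have hC0 : 0 ≤ C := intervalIntegral.integral_nonneg hle fun θ _ => by positivity
  refine le_of_forall_pos_le_add fun δ hδ => ?_
  -- This `ε` keeps the error `2 ε C` below `δ`; the `+ 1` covers the case `C = 0`.
  have h := hflux (δ / (2 * (C + 1))) (by positivity)
  refine h.trans (add_le_add le_rfl ?_)
  have e : 2 * (δ / (2 * (C + 1))) * C = δ * (C / (C + 1)) := by field_simp
  rw [e]
  have : C / (C + 1) ≤ 1 := (div_le_one (by positivity)).2 (by linarith)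
  nlinarith

end Calibration

end

/-! ### Assembly of the theorem -/

theorem mainTheorem4 (z ζ : Plane → ℂ)
    (hz : ContDiffOn ℝ 2 z northDomain)
    (hz0 : ∀ x ∈ northDomain, z x ≠ 0)
    (hfin : IntegrableOn (energyDensity z) northDomain)
    (hcrit : IsCriticalN z)
    (hζ : ζ = inverted z) :
    -- the Euler–Lagrange equations
    (∀ x ∈ northInterior, EulerLagrangeAt (uPart ζ) (vPart ζ) x) ∧
    -- all integrals below converge
    (IntegrableOn (energyDensity ζ) northDomain ∧
      IntegrableOn (logTerm ζ) northDomain ∧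
      IntegrableOn (gradTerm ζ) northDomain ∧
      IntegrableOn (crossTerm ζ) northDomain ∧
      IntegrableOn (partsFirst z) northDomain ∧
      IntegrableOn (partsSecond z) northDomain) ∧
    -- the energy in terms of the inverted map, and its integration by parts
    energyN ζ = energyN z ∧
    energyN ζ = energyByParts northDomain z - circleTerm northDomain z ∧
    -- the decomposition, for the energy without its boundary integral
    energyByParts northDomain z =
      (∫ x in northDomain, -logTerm ζ x) + (∫ x in northDomain, gradTerm ζ x)
        - ∫ x in northDomain, crossTerm ζ x ∧
    -- the boundary integrals cancel in the total energy
    (∀ s : Plane → ℂ, ContDiffOn ℝ 2 s (Metric.closedBall 0 1) →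
      (∀ x ∈ Metric.sphere (0 : Plane) 1, s x = z x ∧
        fderivWithin ℝ s (Metric.closedBall 0 1) x x = fderivWithin ℝ z northDomain x x) →
      energyS s + energyN ζ = energyByParts unitDisk s +
        ((∫ x in northDomain, -logTerm ζ x) + (∫ x in northDomain, gradTerm ζ x)
          - ∫ x in northDomain, crossTerm ζ x)) ∧
    -- the minimal conditions
    ((∀ᵐ x ∂(volume.restrict northDomain), MinimalConditionsAt (uPart ζ) (vPart ζ) x) →
      (ζ ∈ competitorsN ζ ∧ IsMinOn energyN (competitorsN ζ) ζ) ∧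
      energyByParts northDomain z =
        -(∫ x in northDomain, logTerm ζ x) + ∫ x in northDomain, gradTerm ζ x ∧
      energyN ζ =
        -(∫ x in northDomain, logTerm ζ x) + (∫ x in northDomain, gradTerm ζ x)
          - circleTerm northDomain z) := by
  have hU := isOpen_northInterior
  have hzU := hz.mono northInterior_subset
  have hz2 : ∀ x ∈ northInterior, ContDiffAt ℝ 2 z x := fun x hx => hzU.contDiffAt (hU.mem_nhds hx)
  have hz1 : ∀ x ∈ northInterior, DifferentiableAt ℝ z x := fun x hx =>
    (hz2 x hx).differentiableAt (by norm_num)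
  have h0U : ∀ x ∈ northInterior, z x ≠ 0 := fun x hx => hz0 x (northInterior_subset hx)
  have hEL : ∀ x ∈ northInterior, ComplexEL z x := fun x hx =>
    complexEL_of_isCriticalN hzU hfin hcrit hx
  have hζc : ContDiffOn ℝ 2 ζ northDomain := hζ ▸ ContDiffOn.inverted hz hz0
  have hζU := hζc.mono northInterior_subset
  have hζU1 : ContDiffOn ℝ 1 ζ northInterior := hζU.of_le (by norm_num)
  have hζ2 : ∀ x ∈ northInterior, ContDiffAt ℝ 2 ζ x := fun x hx => hζU.contDiffAt (hU.mem_nhds hx)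
  have hζ1 : ∀ x ∈ northInterior, DifferentiableAt ℝ ζ x := fun x hx =>
    (hζ2 x hx).differentiableAt (by norm_num)
  have hζ0 : ∀ x ∈ northDomain, ζ x ≠ 0 := fun x hx => by
    rw [hζ, ← norm_ne_zero_iff, norm_inverted]
    exact inv_ne_zero (norm_ne_zero_iff.2 (hz0 x hx))
  have hELζ : ∀ x ∈ northInterior, ComplexEL ζ x := fun x hx =>
    hζ ▸ ComplexEL.inverted (hz2 x hx) (h0U x hx) (hEL x hx)
  have hdens : ∀ x ∈ northInterior, energyDensity ζ x = energyDensity z x := by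
    intro x hx
    have := hζ1 x hx
    subst hζ
    exact energyDensity_inverted (hz1 x hx) (h0U x hx) this
  have hzU1 : ContDiffOn ℝ 1 z northInterior := hzU.of_le (by norm_num)
  have he := integrableOn_northDomain_iff.1 hfin
  have heζ : IntegrableOn (energyDensity ζ) northInterior :=
    he.congr_fun (fun x hx => (hdens x hx).symm) hU.measurableSet
  have hlog := integrableOn_logTerm hU hζU1 heζ
  have hcross := integrableOn_crossTerm hU hζU1 heζ
  have hgrad : IntegrableOn (gradTerm ζ) northInterior := by
    rw [show gradTerm ζ = fun x => 2 * energyDensity ζ x from funext (gradTerm_eq ζ)]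
    exact heζ.const_mul 2
  have hF := integrableOn_partsFirst hU hzU1 he
  have hS := integrableOn_partsSecond hU hzU he hEL
  have hE : energyN ζ = energyN z := by
    rw [energyN, energyN, dirichletEnergy, dirichletEnergy, integral_northDomain,
      integral_northDomain]
    exact setIntegral_congr_fun hU.measurableSet hdens
  have hparts : energyN ζ = energyByParts northDomain z - circleTerm northDomain z :=
    hE.trans (energyN_eq_energyByParts hz hfin hEL)
  have hdec : energyByParts northDomain z =
      (∫ x in northDomain, -logTerm ζ x) + (∫ x in northDomain, gradTerm ζ x)
        - ∫ x in northDomain, crossTerm ζ x := by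
    have hlg : IntegrableOn (fun x => -logTerm ζ x + gradTerm ζ x) northInterior :=
      hlog.fun_neg.add hgrad
    simp only [energyByParts, integral_northDomain]
    rw [← integral_neg, ← integral_sub hF.fun_neg hS,
      ← integral_add hlog.fun_neg hgrad, ← integral_sub hlg hcross]
    refine setIntegral_congr_fun hU.measurableSet fun x hx => ?_
    have := parts_eq_inverted (hz2 x hx) (h0U x hx) (hEL x hx)
    rw [← hζ] at this
    exact this
  refine ⟨fun x hx => (eulerLagrangeAt_iff (hζ2 x hx)).2 (hELζ x hx),
    ⟨integrableOn_northDomain_iff.2 heζ, integrableOn_northDomain_iff.2 hlog,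
      integrableOn_northDomain_iff.2 hgrad, integrableOn_northDomain_iff.2 hcross,
      integrableOn_northDomain_iff.2 hF, integrableOn_northDomain_iff.2 hS⟩,
    hE, hparts, hdec, fun s hs hsz => ?_, fun hmin => ?_⟩
  -- The circle terms depend only on the values and radial derivatives, which agree, and they enter
  -- with opposite signs in the south and the north.
  · rw [energyS_eq_energyByParts hs, circleTerm_congr hsz, hparts, hdec]
    ring
  · have hang := angD_eq_zero_of_minimal hU hζU hELζ
      (by rwa [Measure.restrict_congr_set northDomain_ae_eq] at hmin)
    have hcr : ∫ x in northDomain, crossTerm ζ x = 0 := by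
      rw [integral_northDomain]
      refine setIntegral_eq_zero_of_forall_eq_zero fun x hx => ?_
      rw [crossTerm_eq (hζ1 x hx), hang x hx, mul_zero, zero_div]
    have hdec' : energyByParts northDomain z =
        -(∫ x in northDomain, logTerm ζ x) + ∫ x in northDomain, gradTerm ζ x := by
      rw [hdec, hcr, sub_zero, integral_neg]
    refine ⟨⟨⟨hζc.continuousOn, hζU1, integrableOn_northDomain_iff.2 heζ, fun _ _ => rfl⟩,
      isMinOn_energyN hζc hζ0 (integrableOn_northDomain_iff.2 heζ) hELζ hang⟩, hdec', ?_⟩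
    rw [hparts, hdec']
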